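/- **Setting.** Let $\sigma$ be the surface measure on the unit sphere $\mathbb S^5\subset\mathbb R^6$ (so $\sigma(\mathbb S^5)=\pi^3$). For $k\ge 0$ let $\mathcal H_k$ be the space of spherical harmonics of degree $k$, i.e. the restrictions to $\mathbb S^5$ of the real homogeneous harmonic polynomials of degree $k$ on $\mathbb R^6$, and let $\alpha_k=\dim\mathcal H_k$, that is, $\alpha_0=1$, $\alpha_1=6$ and $\alpha_k=\binom{k+5}{k}-\binom{k+3}{k-2}$ for $k\ge 2$. For every $k$ let $(Y_{k,j})_{1\le j\le\alpha_k}$ be a basis of $\mathcal H_k$ with $$\int_{\mathbb S^5}Y_{k,i}Y_{k,j}\,d\sigma=\pi^3\ \text{ if } i=j,\qquad \int_{\mathbb S^5}Y_{k,i}Y_{k,j}\,d\sigma=0\ \text{ if } i\ne j.$$ For a real-valued $f\in L^2(\mathbb R^6)$ put $$\Phi f(x)=\int_{\mathbb R^6}\frac{f(y)}{|x-y|^4}\,dy,\qquad f_{k,j}(r)=\frac1{\pi^3}\int_{\mathbb S^5}f(r\xi)Y_{k,j}(\xi)\,d\sigma(\xi),$$ and, for $r,\rho>0$, $$\mathcal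 K_k(r,\rho)=\frac{2\pi^3}{k+2}\begin{cases}\dfrac{r^{k+5}}{\rho^{k+4}},& r<\rho,\\[2mm] \dfrac{\rho^{k}}{r^{k-1}},& r>\rho.\end{cases}$$ **Proposition.** For every real-valued $f\in L^2(\mathbb R^6)$ we have $$\Phi f(x)=\sum_{k=0}^\infty\sum_{j=1}^{\alpha_k}\left(\int_0^\infty\mathcal K_k(r,|x|)\,f_{k,j}(r)\,dr\right)Y_{k,j}\!\left(\frac{x}{|x|}\right)$$ in the following sense. 1. For all $k$, $j$ and all $\rho>0$ the integral $\int_0^\infty\mathcal K_k(r,\rho)f_{k,j}(r)\,dr$ converges absolutely. 2. For almost every $x\in\mathbb R^6$ the integral defining $\Phi f(x)$ converges absolutely, and the series over $k$ (of the finite sums over $j$) converges absolutely to $\Phi f(x)$. 3. For every $\rho>0$ the series with $x=\rho\xi$, as a series over $k$ of functions of $\xi\in\mathbb S^5$, converges to $\xi\mapsto\Phi f(\rho\xi)$ in $L^2(\mathbb S^5,\sigma)$. -/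

import Mathlib

open MeasureTheory Filter Topology Real

noncomputable section

namespace NewtonHarmonic

/-- Euclidean space `ℝ⁶`. -/
abbrev E6 : Type := EuclideanSpace ℝ (Fin 6)

/-- The unit sphere `𝕊⁵` of `ℝ⁶`. -/
abbrev S5 : Type := Metric.sphere (0 : E6) 1

/-- The surface measure on `𝕊⁵` (of total mass `π ^ 3`). -/
def surfaceMeasure : Measure S5 := (volume : Measure E6).toSphere

/-- The direction `x / |x|` of a nonzero vector, as a point of `𝕊⁵`. -/
def direction (x : E6) (hx : x ≠ 0) : S5 :=
  ⟨‖x‖⁻¹ • x, by simp [norm_smul, hx]⟩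

/-- The Newtonian potential `Φ f (x) = ∫ f(y) / |x - y| ^ 4 dy` on `ℝ⁶`. -/
def newtonPotential (f : E6 → ℝ) (x : E6) : ℝ :=
  ∫ y, f y / ‖x - y‖ ^ 4

/-- The Laplacian `∑ ∂ᵢ ∂ᵢ` on real polynomials in six variables. -/
def polyLaplacian : MvPolynomial (Fin 6) ℝ →ₗ[ℝ] MvPolynomial (Fin 6) ℝ :=
  ∑ i, (MvPolynomial.pderiv (R := ℝ) i).toLinearMap ∘ₗ
    (MvPolynomial.pderiv (R := ℝ) i).toLinearMap

/-- Restriction of polynomials in six variables to functions on `𝕊⁵`. -/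
def restrictToSphere : MvPolynomial (Fin 6) ℝ →ₗ[ℝ] (S5 → ℝ) :=
  LinearMap.pi fun ξ : S5 =>
    (MvPolynomial.aeval (R := ℝ) fun i => (ξ : E6) i).toLinearMap

/-- The space of spherical harmonics of degree `k` on `𝕊⁵`: the restrictions to `𝕊⁵` of the real
homogeneous harmonic polynomials of degree `k`. -/
def sphericalHarmonics (k : ℕ) : Submodule ℝ (S5 → ℝ) :=
  (MvPolynomial.homogeneousSubmodule (Fin 6) ℝ k ⊓ LinearMap.ker polyLaplacian).map
    restrictToSphere

/-- The dimension of the space of spherical harmonics of degree `k` on `𝕊⁵`. -/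
def harmonicDim (k : ℕ) : ℕ :=
  if k = 0 then 1
  else if k = 1 then 6
  else (k + 5).choose k - (k + 3).choose (k - 2)

/-- For every degree `k`, the functions `Y k j` form an orthogonal basis of the space of spherical
harmonics of degree `k`, normalized by `∫ (Y k j) ^ 2 = π ^ 3`. -/
structure IsHarmonicBasis (Y : (k : ℕ) → Fin (harmonicDim k) → S5 → ℝ) : Prop where
  span_eq : ∀ k, Submodule.span ℝ (Set.range (Y k)) = sphericalHarmonics k
  integral_mul : ∀ k (i j : Fin (harmonicDim k)),
    ∫ ξ, Y k i ξ * Y k j ξ ∂surfaceMeasure = if i = j then π ^ 3 else 0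

/-- The coefficient `π⁻³ ∫ f(r ξ) y(ξ) dσ(ξ)` of `f` at radius `r` along a function `y`
on the sphere. -/
def coeff (y : S5 → ℝ) (f : E6 → ℝ) (r : ℝ) : ℝ :=
  1 / π ^ 3 * ∫ ξ : S5, f (r • (ξ : E6)) * y ξ ∂surfaceMeasure

/-- The kernel `K_k(r, ρ)`. The second exponent is an integer, equal to `-1` for `k = 0`;
the two formulas agree at `r = ρ`. -/
def kernel (k : ℕ) (r ρ : ℝ) : ℝ :=
  2 * π ^ 3 / ((k : ℝ) + 2) *
    if r < ρ then r ^ (k + 5) / ρ ^ (k + 4) else ρ ^ k / r ^ ((k : ℤ) - 1)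

/-- The radial integral `∫₀^∞ K_k(r, ρ) π⁻³ (∫ f(r ξ) y(ξ) dσ(ξ)) dr`. -/
def radialIntegral (k : ℕ) (y : S5 → ℝ) (f : E6 → ℝ) (ρ : ℝ) : ℝ :=
  ∫ r in Set.Ioi (0 : ℝ), kernel k r ρ * coeff y f r

end NewtonHarmonic

end

/-!
The Newtonian kernel is expanded in spherical harmonics by hand, and the expansion is then carried
over to the potential by estimates in `L²` of a single sphere.

*The kernel.* A zonal polynomial is one whose values depend only on the norm and on the component
along a fixed pole. A zonal homogeneous harmonic polynomial which vanishes at the pole is zero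
(`IsSolidHarmonic.eq_zero_of_isZonal`), so identities between zonal harmonics can be checked at the
pole. For zonal harmonics normalized like the Gegenbauer polynomials `C_k^{(2)}` this gives the
three-term recurrence (`IsGegenbauerFamily.recurrence`) and from it the generating function
`∑ C_k^{(2)}(a) t^k = (1 - 2at + t²)⁻²` (`hasSum_gegenbauer`). The reproducing kernel
`R_k(ξ, η) = ∑ⱼ Y_{k,j}(ξ) Y_{k,j}(η)` is invariant under orthogonal maps, hence zonal in each
variable, and its value on the diagonal is the trace `dim ℋ_k` because the sphere has measure `π³`;
so `2 / (k + 2) * R_k` is the zonal harmonic with the Gegenbauer normalization. For `|x| = ρ`,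
`|y| = s ≠ ρ`, the generating function at `t = min(s, ρ) / max(s, ρ)` becomes
`|x - y|⁻⁴ = ∑ₖ 2 / (k + 2) * u_k(s) * R_k(x / |x|, y / |y|)` with
`u_k(s) = min(s, ρ)^k / max(s, ρ)^(k+4)` (`IsHarmonicBasis.hasSum_newton`).

*The potential.* In polar coordinates the radial integrals are `2 / (k + 2)` times the inner products
of `f` with the functions `u_k(|y|) Y_{k,j}(y / |y|)`, which for fixed `k` are orthogonal in `L²(ℝ⁶)`
with squared norm at most `π³ ρ⁻² / (k + 1)` (`IsHarmonicBasis.radialIntegral_eq`). By Bessel's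
inequality the term `T_k f` of degree `k` satisfies `‖T_k f‖_{L²(𝕊⁵)} ≤ c_k ‖f‖` with
`c_k = O(k^{-3/2})` (`IsHarmonicBasis.eLpNorm_degreeTerm_le`). Since `∑ c_k` converges, the series
converges absolutely in `L²` of every sphere, and absolutely at almost every point of it. No
orthogonality between different degrees and no completeness of the spherical harmonics is needed.

*The limit.* If `f` vanishes near the sphere of radius `ρ`, the kernel expansion can be integrated
term by term (`IsHarmonicBasis.hasSum_of_support`), so the sum is `Φ f` and
`‖Φ f(ρ ·)‖_{L²(𝕊⁵)} ≤ (∑ c_k) ‖f‖`. Cutting off a shrinking shell around the sphere, monotone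
convergence for `|f|` shows that the potential converges absolutely almost everywhere on the sphere,
and dominated convergence together with the bound on `f` minus its truncations identifies the sum of
the series with `Φ f` (`IsHarmonicBasis.ae_hasSum`). The statement almost everywhere in `ℝ⁶` follows
by Fubini's theorem in polar coordinates, the set of good points being measurable.
-/

noncomputable section

namespace NewtonHarmonic

/-! ### Zonal harmonic polynomials -/

/-- The value of a polynomial in six variables at a point of `ℝ⁶`. -/
def polyEval (p : MvPolynomial (Fin 6) ℝ) (x : E6) : ℝ :=
  MvPolynomial.eval (fun i => x i) p

/-- The first vector of the standard basis, the pole of all zonal polynomials. -/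
def pole : E6 := EuclideanSpace.single 0 1

/-- The polynomial `|x|²`. -/
def normSqPoly : MvPolynomial (Fin 6) ℝ := ∑ i, MvPolynomial.X i ^ 2

/-- A polynomial is zonal if its values depend only on the norm and the component along `pole`. -/
def IsZonal (p : MvPolynomial (Fin 6) ℝ) : Prop :=
  ∀ x y : E6, ‖x‖ = ‖y‖ → x 0 = y 0 → polyEval p x = polyEval p y

/-- A solid spherical harmonic of degree `k`: a homogeneous harmonic polynomial. -/
def IsSolidHarmonic (k : ℕ) (p : MvPolynomial (Fin 6) ℝ) : Prop :=
  p.IsHomogeneous k ∧ polyLaplacian p = 0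

lemma polyEval_add (p q : MvPolynomial (Fin 6) ℝ) (x : E6) :
    polyEval (p + q) x = polyEval p x + polyEval q x := by simp [polyEval]

lemma polyEval_mul (p q : MvPolynomial (Fin 6) ℝ) (x : E6) :
    polyEval (p * q) x = polyEval p x * polyEval q x := by simp [polyEval]

lemma polyEval_C (c : ℝ) (x : E6) : polyEval (MvPolynomial.C c) x = c := by simp [polyEval]

lemma polyEval_X (i : Fin 6) (x : E6) : polyEval (MvPolynomial.X i) x = x i := by simp [polyEval]

lemma polyEval_normSqPoly (x : E6) : polyEval normSqPoly x = ‖x‖ ^ 2 := by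
  simp [polyEval, normSqPoly, EuclideanSpace.norm_sq_eq]

lemma polyEval_injective {p q : MvPolynomial (Fin 6) ℝ} (h : ∀ x, polyEval p x = polyEval q x) :
    p = q :=
  MvPolynomial.funext fun v => h (WithLp.toLp 2 v)

lemma continuous_polyEval (p : MvPolynomial (Fin 6) ℝ) : Continuous (polyEval p) := by
  unfold polyEval
  exact (MvPolynomial.continuous_eval p).comp (by fun_prop)

lemma polyEval_smul {k : ℕ} {p : MvPolynomial (Fin 6) ℝ} (hp : p.IsHomogeneous k) (r : ℝ) (x : E6) :
    polyEval p (r • x) = r ^ k * polyEval p x := by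
  unfold polyEval
  rw [MvPolynomial.eval_eq, MvPolynomial.eval_eq, Finset.mul_sum]
  refine Finset.sum_congr rfl fun d hd => ?_
  have : ∑ i ∈ d.support, d i = k := (hp.degree_eq_sum_deg_support hd).symm
  simp only [PiLp.smul_apply, smul_eq_mul, mul_pow, Finset.prod_mul_distrib]
  rw [Finset.prod_pow_eq_pow_sum, this]
  ring

lemma polyLaplacian_apply (p : MvPolynomial (Fin 6) ℝ) :
    polyLaplacian p = ∑ i, MvPolynomial.pderiv i (MvPolynomial.pderiv i p) := by
  simp [polyLaplacian]

lemma pderiv_comm (i j : Fin 6) (p : MvPolynomial (Fin 6) ℝ) :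
    MvPolynomial.pderiv i (MvPolynomial.pderiv j p) =
      MvPolynomial.pderiv j (MvPolynomial.pderiv i p) := by
  have h : ⁅MvPolynomial.pderiv (R := ℝ) i, MvPolynomial.pderiv (R := ℝ) j⁆ = 0 := by
    refine MvPolynomial.derivation_ext fun m => ?_
    rw [Derivation.commutator_apply, MvPolynomial.pderiv_X, MvPolynomial.pderiv_X]
    simp only [Pi.single_apply]
    split_ifs <;> simp
  have := congrArg (fun D => D p) h
  rw [Derivation.commutator_apply] at this
  exact sub_eq_zero.1 this

lemma polyLaplacian_pderiv (i : Fin 6) (p : MvPolynomial (Fin 6) ℝ) :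
    polyLaplacian (MvPolynomial.pderiv i p) = MvPolynomial.pderiv i (polyLaplacian p) := by
  simp only [polyLaplacian_apply, map_sum]
  exact Finset.sum_congr rfl fun j _ => by rw [pderiv_comm j i, pderiv_comm j i]

lemma hasDerivAt_polyEval (p : MvPolynomial (Fin 6) ℝ) (i : Fin 6) (x : E6) (s : ℝ) :
    HasDerivAt (fun s : ℝ => polyEval p (x + s • EuclideanSpace.single i 1))
      (polyEval (MvPolynomial.pderiv i p) (x + s • EuclideanSpace.single i 1)) s := by
  induction p using MvPolynomial.induction_on with
  | C a => simpa [polyEval] using hasDerivAt_const s a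
  | add p q hp hq =>
    simp only [map_add, polyEval_add]
    exact hp.add hq
  | mul_X p j hp =>
    have hX : HasDerivAt (fun s : ℝ => (x + s • EuclideanSpace.single i 1 : E6) j)
        (if j = i then 1 else 0) s := by
      simp only [PiLp.add_apply, PiLp.smul_apply, PiLp.single_apply, smul_eq_mul]
      simpa using ((hasDerivAt_id s).mul_const (if j = i then (1 : ℝ) else 0)).const_add (x j)
    have h := hp.mul hX
    simp only [polyEval_mul, polyEval_X]
    refine h.congr_deriv ?_
    rw [Derivation.leibniz, polyEval_add, smul_eq_mul, smul_eq_mul, polyEval_mul, polyEval_mul,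
      MvPolynomial.pderiv_X, polyEval_X]
    by_cases hij : j = i
    · subst hij; simp [polyEval]; ring
    · simp [polyEval, hij]; ring

lemma IsZonal.pderiv_zero {p : MvPolynomial (Fin 6) ℝ} (hp : IsZonal p) :
    IsZonal (MvPolynomial.pderiv 0 p) := by
  intro x y hxy h0
  have hx := hasDerivAt_polyEval p 0 x 0
  have hy := hasDerivAt_polyEval p 0 y 0
  have : (fun s : ℝ => polyEval p (x + s • EuclideanSpace.single 0 1)) =
      fun s : ℝ => polyEval p (y + s • EuclideanSpace.single 0 1) := by
    funext s
    refine hp _ _ ?_ (by simp [h0])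
    have : ‖x + s • (EuclideanSpace.single 0 1 : E6)‖ ^ 2 =
        ‖y + s • (EuclideanSpace.single 0 1 : E6)‖ ^ 2 := by
      rw [norm_add_sq_real, norm_add_sq_real, hxy]
      simp [inner_smul_right, EuclideanSpace.inner_single_right, h0]
    exact (sq_eq_sq₀ (norm_nonneg _) (norm_nonneg _)).1 this
  rw [this] at hx
  simpa using hx.unique hy

lemma polyEval_pole_pderiv {k : ℕ} {p : MvPolynomial (Fin 6) ℝ} (hp : p.IsHomogeneous k) :
    polyEval (MvPolynomial.pderiv 0 p) pole = k * polyEval p pole := by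
  have h := congrArg (fun q => polyEval q pole) hp.sum_X_mul_pderiv
  simpa [polyEval, pole] using h

lemma IsSolidHarmonic.pderiv {k : ℕ} {p : MvPolynomial (Fin 6) ℝ} (hp : IsSolidHarmonic (k + 1) p)
    (i : Fin 6) : IsSolidHarmonic k (MvPolynomial.pderiv i p) :=
  ⟨hp.1.pderiv, by rw [polyLaplacian_pderiv, hp.2, map_zero]⟩

/-- A power of `x₁² + ⋯ + x₅²` with positive exponent is not harmonic. -/
lemma polyLaplacian_equatorial_pow_ne_zero (n : ℕ) :
    polyEval (polyLaplacian ((∑ i : Fin 5, MvPolynomial.X i.succ ^ 2) ^ (n + 1)))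
      (EuclideanSpace.single 1 1) ≠ 0 := by
  set S : MvPolynomial (Fin 6) ℝ := ∑ i : Fin 5, MvPolynomial.X i.succ ^ 2 with hS
  have he : ∑ i : Fin 5, ((EuclideanSpace.single 1 1 : E6) i.succ) ^ 2 = 1 := by
    rw [Finset.sum_eq_single 0 (fun i _ hi => ?_) (by simp), Fin.succ_zero_eq_one]
    · simp
    · rw [PiLp.single_apply, if_neg, zero_pow two_ne_zero]
      rwa [← Fin.succ_zero_eq_one, Fin.succ_inj]
  have hS1 : MvPolynomial.eval (fun i => (EuclideanSpace.single 1 1 : E6) i) S = 1 := by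
    simpa only [hS, map_sum, map_pow, MvPolynomial.eval_X] using he
  have h0 : MvPolynomial.pderiv 0 S = 0 := by
    simp [hS, MvPolynomial.pderiv_X, Fin.succ_ne_zero]
  have hs : ∀ i : Fin 5, MvPolynomial.pderiv i.succ S = 2 * MvPolynomial.X i.succ := by
    intro i
    simp [hS, MvPolynomial.pderiv_X, Pi.single_apply]
  have h1 : ∀ i : Fin 5, MvPolynomial.pderiv i.succ (S ^ (n + 1)) =
      MvPolynomial.C (2 * (n + 1) : ℝ) * (S ^ n * MvPolynomial.X i.succ) := by
    intro i
    rw [MvPolynomial.pderiv_pow, hs]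
    simp only [map_mul, map_add, map_natCast, map_ofNat, map_one, Nat.add_sub_cancel]
    push_cast
    ring
  have h2 : ∀ i : Fin 5, polyEval (MvPolynomial.pderiv i.succ (MvPolynomial.pderiv i.succ
      (S ^ (n + 1)))) (EuclideanSpace.single 1 1) =
      2 * (n + 1) * (1 + 2 * n * ((EuclideanSpace.single 1 1 : E6) i.succ) ^ 2) := by
    intro i
    rw [h1, MvPolynomial.pderiv_C_mul, MvPolynomial.pderiv_mul, MvPolynomial.pderiv_pow, hs,
      MvPolynomial.pderiv_X_self]
    simp only [polyEval, map_mul, map_add, map_pow, hS1, MvPolynomial.eval_X,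
      map_natCast, map_ofNat, map_one, one_pow]
    ring
  have key : polyEval (polyLaplacian (S ^ (n + 1))) (EuclideanSpace.single 1 1) =
      2 * (n + 1) * (2 * n + 5) := by
    have h3 : ∀ q : Fin 6 → MvPolynomial (Fin 6) ℝ, ∀ x : E6,
        polyEval (∑ i, q i) x = ∑ i, polyEval (q i) x := by
      intro q x
      simp [polyEval]
    rw [polyLaplacian_apply, h3, Fin.sum_univ_succ, Finset.sum_congr rfl fun i _ => h2 i,
      MvPolynomial.pderiv_pow, h0, mul_zero, map_zero]
    rw [← Finset.mul_sum, Finset.sum_add_distrib, ← Finset.mul_sum, he]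
    simp only [polyEval, map_zero, Finset.sum_const, Finset.card_univ, Fintype.card_fin]
    simp only [nsmul_eq_mul]
    push_cast
    ring
  rw [key]
  positivity

/-- A zonal harmonic is determined by its value at the pole. The derivative along the axis is a
zonal harmonic of lower degree which vanishes at the pole as well (Euler's identity), so by
induction the polynomial does not depend on `x₀`; it is then a multiple of a power of
`x₁² + ⋯ + x₅²`, hence not harmonic unless it is zero. -/
theorem IsSolidHarmonic.eq_zero_of_isZonal {k : ℕ} {p : MvPolynomial (Fin 6) ℝ}
    (hp : IsSolidHarmonic k p) (hz : IsZonal p) (h0 : polyEval p pole = 0) : p = 0 := by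
  induction k generalizing p with
  | zero =>
    have h := (MvPolynomial.totalDegree_zero_iff_isHomogeneous _).2 hp.1
    rw [MvPolynomial.totalDegree_eq_zero_iff_eq_C] at h
    rw [h, polyEval_C] at h0
    rw [h, h0, map_zero]
  | succ k ih =>
    have hd : MvPolynomial.pderiv 0 p = 0 :=
      ih (hp.pderiv 0) hz.pderiv_zero (by rw [polyEval_pole_pderiv hp.1, h0, mul_zero])
    have hconst : ∀ (x : E6) (s : ℝ), polyEval p (x + s • EuclideanSpace.single 0 1) =
        polyEval p x := by
      intro x s
      have := is_const_of_deriv_eq_zero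
        (f := fun s : ℝ => polyEval p (x + s • EuclideanSpace.single 0 1))
        (fun s => (hasDerivAt_polyEval p 0 x s).differentiableAt)
        (fun s => by rw [(hasDerivAt_polyEval p 0 x s).deriv, hd]; simp [polyEval]) s 0
      simpa using this
    -- Translating along the axis and using zonality, every point moves to the line through `e₁`.
    set e₁ : E6 := EuclideanSpace.single 1 1 with he₁
    set d := polyEval p e₁ with hdef
    have hval : ∀ x : E6, polyEval p x =
        √(∑ i : Fin 5, x i.succ ^ 2) ^ (k + 1) * d := by
      intro x
      rw [← hconst x (-x 0), hdef, ← polyEval_smul hp.1]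
      refine hz _ _ ?_ ?_
      · rw [norm_smul, he₁, PiLp.norm_single, EuclideanSpace.norm_eq, Fin.sum_univ_succ]
        simp [abs_of_nonneg]
      · simp [he₁]
    -- In odd degree, `p` changes sign under `e₁ ↦ -e₁`, which zonality excludes.
    have hd0 : d = 0 := by
      rcases Nat.even_or_odd (k + 1) with he | ho
      · obtain ⟨m, hm⟩ := he
        obtain ⟨n, rfl⟩ : ∃ n, m = n + 1 := ⟨m - 1, by omega⟩
        have hpoly : p = d • (∑ i : Fin 5, MvPolynomial.X i.succ ^ 2) ^ (n + 1) := by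
          refine polyEval_injective fun x => ?_
          rw [hval, hm, ← two_mul, pow_mul, Real.sq_sqrt (by positivity)]
          simp [polyEval, mul_comm]
        by_contra hne
        have h := hp.2
        rw [hpoly, map_smul, smul_eq_zero] at h
        refine polyLaplacian_equatorial_pow_ne_zero n ?_
        rw [h.resolve_left hne]
        simp [polyEval]
      · have h1 : polyEval p (-e₁) = -d := by
          have := polyEval_smul hp.1 (-1) e₁
          rwa [neg_one_smul, ho.neg_one_pow, neg_one_mul] at this
        have h2 : polyEval p (-e₁) = d := hz _ _ (norm_neg _) (by simp [he₁])
        linarith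
    refine polyEval_injective fun x => ?_
    rw [hval, hd0]
    simp [polyEval]

/-! ### The recurrence and the generating function of zonal harmonics -/

lemma polyEval_smul_poly (c : ℝ) (p : MvPolynomial (Fin 6) ℝ) (x : E6) :
    polyEval (c • p) x = c * polyEval p x := by simp [polyEval]

lemma norm_pole : ‖pole‖ = 1 := by simp [pole]

lemma pole_zero : pole 0 = 1 := by simp [pole]

lemma IsZonal.add {p q : MvPolynomial (Fin 6) ℝ} (hp : IsZonal p) (hq : IsZonal q) :
    IsZonal (p + q) := fun x y h h0 => by
  rw [polyEval_add, polyEval_add, hp x y h h0, hq x y h h0]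

lemma IsZonal.mul {p q : MvPolynomial (Fin 6) ℝ} (hp : IsZonal p) (hq : IsZonal q) :
    IsZonal (p * q) := fun x y h h0 => by
  rw [polyEval_mul, polyEval_mul, hp x y h h0, hq x y h h0]

lemma IsZonal.smul {p : MvPolynomial (Fin 6) ℝ} (hp : IsZonal p) (c : ℝ) :
    IsZonal (c • p) := fun x y h h0 => by
  rw [polyEval_smul_poly, polyEval_smul_poly, hp x y h h0]

lemma isZonal_X_zero : IsZonal (MvPolynomial.X 0) := fun x y _ h0 => by
  rw [polyEval_X, polyEval_X, h0]

lemma isZonal_normSqPoly : IsZonal normSqPoly := fun x y h _ => by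
  rw [polyEval_normSqPoly, polyEval_normSqPoly, h]

lemma isHomogeneous_normSqPoly : normSqPoly.IsHomogeneous 2 :=
  MvPolynomial.IsHomogeneous.sum _ _ _ fun i _ => MvPolynomial.isHomogeneous_X_pow i 2

lemma IsSolidHarmonic.add {k : ℕ} {p q : MvPolynomial (Fin 6) ℝ} (hp : IsSolidHarmonic k p)
    (hq : IsSolidHarmonic k q) : IsSolidHarmonic k (p + q) :=
  ⟨hp.1.add hq.1, by rw [map_add, hp.2, hq.2, add_zero]⟩

lemma IsSolidHarmonic.smul {k : ℕ} {p : MvPolynomial (Fin 6) ℝ} (hp : IsSolidHarmonic k p)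
    (c : ℝ) : IsSolidHarmonic k (c • p) :=
  ⟨by rw [MvPolynomial.smul_eq_C_mul]; exact hp.1.C_mul c, by rw [map_smul, hp.2, smul_zero]⟩

lemma IsSolidHarmonic.eq_of_isZonal {k : ℕ} {p q : MvPolynomial (Fin 6) ℝ}
    (hp : IsSolidHarmonic k p) (hq : IsSolidHarmonic k q) (hzp : IsZonal p) (hzq : IsZonal q)
    (h : polyEval p pole = polyEval q pole) : p = q := by
  have := (hp.add (hq.smul (-1))).eq_zero_of_isZonal (hzp.add (hzq.smul (-1)))
    (by rw [polyEval_add, polyEval_smul_poly, h]; ring)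
  rwa [neg_one_smul, ← sub_eq_add_neg, sub_eq_zero] at this

lemma polyLaplacian_X_mul (i : Fin 6) (p : MvPolynomial (Fin 6) ℝ) :
    polyLaplacian (MvPolynomial.X i * p) =
      MvPolynomial.X i * polyLaplacian p + 2 * MvPolynomial.pderiv i p := by
  have h : ∀ j, MvPolynomial.pderiv j (MvPolynomial.pderiv j (MvPolynomial.X i * p)) =
      MvPolynomial.X i * MvPolynomial.pderiv j (MvPolynomial.pderiv j p) +
      if j = i then 2 * MvPolynomial.pderiv i p else 0 := by
    intro j
    by_cases hj : j = i
    · subst hj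
      simp only [MvPolynomial.pderiv_mul, MvPolynomial.pderiv_X_self, map_add, if_pos, one_mul]
      ring
    · simp only [MvPolynomial.pderiv_mul, MvPolynomial.pderiv_X_of_ne (Ne.symm hj),
        zero_mul, if_neg hj, zero_add, add_zero]
  rw [polyLaplacian_apply, polyLaplacian_apply, Finset.sum_congr rfl fun j _ => h j,
    Finset.sum_add_distrib, Finset.mul_sum]
  simp

lemma polyLaplacian_normSqPoly_mul {k : ℕ} {p : MvPolynomial (Fin 6) ℝ}
    (hp : IsSolidHarmonic k p) :
    polyLaplacian (normSqPoly * p) = (12 + 4 * k : ℝ) • p := by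
  have h : ∀ i, polyLaplacian (MvPolynomial.X i ^ 2 * p) =
      2 * p + 4 * (MvPolynomial.X i * MvPolynomial.pderiv i p) := by
    intro i
    rw [pow_two, mul_assoc, polyLaplacian_X_mul, polyLaplacian_X_mul, hp.2, MvPolynomial.pderiv_mul,
      MvPolynomial.pderiv_X_self]
    ring
  rw [normSqPoly, Finset.sum_mul, map_sum, Finset.sum_congr rfl fun i _ => h i,
    Finset.sum_add_distrib, ← Finset.mul_sum, ← Finset.mul_sum, hp.1.sum_X_mul_pderiv, MvPolynomial.smul_eq_C_mul]
  simp only [Finset.sum_const, Finset.card_univ, Fintype.card_fin, nsmul_eq_mul, map_add, map_mul,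
    map_natCast, map_ofNat]
  push_cast
  ring

/-- A sequence of zonal harmonics, one in each degree, with the value `C_k^{(2)}(1) = (k+3 choose 3)`
of the Gegenbauer polynomials at the pole. -/
structure IsGegenbauerFamily (q : ℕ → MvPolynomial (Fin 6) ℝ) : Prop where
  harmonic : ∀ k, IsSolidHarmonic k (q k)
  zonal : ∀ k, IsZonal (q k)
  eval_pole : ∀ k, polyEval (q k) pole = (k + 1) * (k + 2) * (k + 3) / 6

namespace IsGegenbauerFamily

variable {q : ℕ → MvPolynomial (Fin 6) ℝ}

/-- Both sides are zonal harmonics, and Euler's identity gives the left one at the pole. -/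
lemma pderiv_succ (hq : IsGegenbauerFamily q) (k : ℕ) :
    MvPolynomial.pderiv 0 (q (k + 1)) = (k + 4 : ℝ) • q k := by
  refine ((hq.harmonic (k + 1)).pderiv 0).eq_of_isZonal ((hq.harmonic k).smul _)
    (hq.zonal _).pderiv_zero ((hq.zonal k).smul _) ?_
  rw [polyEval_pole_pderiv (hq.harmonic (k + 1)).1, polyEval_smul_poly, hq.eval_pole, hq.eval_pole]
  push_cast
  ring

lemma zero (hq : IsGegenbauerFamily q) : q 0 = 1 := by
  refine (hq.harmonic 0).eq_of_isZonal ⟨MvPolynomial.isHomogeneous_one _ _, ?_⟩ (hq.zonal 0)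
    (fun x y _ _ => by simp [polyEval]) ?_
  · simp [polyLaplacian_apply]
  · rw [hq.eval_pole]
    simp [polyEval]
    norm_num

lemma one (hq : IsGegenbauerFamily q) : q 1 = (4 : ℝ) • MvPolynomial.X 0 := by
  refine (hq.harmonic 1).eq_of_isZonal (IsSolidHarmonic.smul ⟨MvPolynomial.isHomogeneous_X _ _, ?_⟩ _)
    (hq.zonal 1) (isZonal_X_zero.smul _) ?_
  · rw [polyLaplacian_apply]
    refine Finset.sum_eq_zero fun i _ => ?_
    by_cases h : i = 0
    · subst h
      rw [MvPolynomial.pderiv_X_self, MvPolynomial.pderiv_one]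
    · rw [MvPolynomial.pderiv_X_of_ne (Ne.symm h), map_zero]
  · rw [hq.eval_pole, polyEval_smul_poly, polyEval_X, pole_zero]
    norm_num

/-- The three-term recurrence: both sides are zonal harmonics with the same value at the pole. -/
lemma recurrence (hq : IsGegenbauerFamily q) (k : ℕ) :
    (k + 2 : ℝ) • q (k + 2) =
      (2 * (k + 3) : ℝ) • (MvPolynomial.X 0 * q (k + 1)) +
        (-(k + 4) : ℝ) • (normSqPoly * q k) := by
  refine ((hq.harmonic (k + 2)).smul _).eq_of_isZonal ⟨?_, ?_⟩ ((hq.zonal _).smul _)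
    (((isZonal_X_zero.mul (hq.zonal _)).smul _).add ((isZonal_normSqPoly.mul (hq.zonal _)).smul _))
    ?_
  · refine MvPolynomial.IsHomogeneous.add ?_ ?_
    · rw [MvPolynomial.smul_eq_C_mul, show k + 2 = 1 + (k + 1) by ring]
      exact ((MvPolynomial.isHomogeneous_X _ _).mul (hq.harmonic _).1).C_mul _
    · rw [MvPolynomial.smul_eq_C_mul, show k + 2 = 2 + k by ring]
      exact (isHomogeneous_normSqPoly.mul (hq.harmonic _).1).C_mul _
  · rw [map_add, map_smul, map_smul, polyLaplacian_X_mul, (hq.harmonic _).2, hq.pderiv_succ,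
      polyLaplacian_normSqPoly_mul (hq.harmonic k)]
    simp only [MvPolynomial.smul_eq_C_mul, map_add, map_mul, map_natCast, map_ofNat, map_neg]
    ring
  · simp only [polyEval_add, polyEval_smul_poly, polyEval_mul, polyEval_X, polyEval_normSqPoly,
      norm_pole, pole_zero, hq.eval_pole]
    push_cast
    ring

end IsGegenbauerFamily

/-- The generating function `(1 - 2at + t²)⁻²` of a sequence which satisfies the
recurrence of the Gegenbauer polynomials `C_k^{(2)}(a)`. The recurrence says that the formal power
series `F` with these coefficients solves `D F' = -2 D' F`, where `D = 1 - 2at + t²`. Therefore the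
coefficients of `D² F` satisfy `D (D² F)' = 0` and vanish beyond the constant term. -/
theorem hasSum_gegenbauer {c : ℕ → ℝ} {a t : ℝ} (h0 : c 0 = 1) (h1 : c 1 = 4 * a)
    (hrec : ∀ k : ℕ, (k + 2) * c (k + 2) = 2 * (k + 3) * a * c (k + 1) - (k + 4) * c k)
    (hs : Summable fun k => c k * t ^ k) :
    HasSum (fun k => c k * t ^ k) (((1 - 2 * a * t + t ^ 2) ^ 2)⁻¹) := by
  have h2 : c 2 = 12 * a ^ 2 - 2 := by
    have := hrec 0
    norm_num [h0, h1] at this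
    linarith
  have h3 : c 3 = 32 * a ^ 3 - 12 * a := by
    have := hrec 1
    norm_num [h1, h2] at this
    linarith
  have h4 : c 4 = 80 * a ^ 4 - 48 * a ^ 2 + 3 := by
    have := hrec 2
    norm_num [h2, h3] at this
    linarith
  have h5 : c 5 = 192 * a ^ 5 - 160 * a ^ 3 + 24 * a := by
    have := hrec 3
    norm_num [h3, h4] at this
    linarith
  -- The coefficients of `D² F` of degree at least four; their recurrence
  -- has two terms, so two consecutive ones are shown to vanish together.
  have hE : ∀ n, c (n + 4) - 4 * a * c (n + 3) + (2 + 4 * a ^ 2) * c (n + 2) - 4 * a * c (n + 1)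
      + c n = 0 ∧ c (n + 5) - 4 * a * c (n + 4) + (2 + 4 * a ^ 2) * c (n + 3)
      - 4 * a * c (n + 2) + c (n + 1) = 0 := by
    intro n
    induction n with
    | zero =>
      simp only [zero_add]
      rw [h0, h1, h2, h3, h4, h5]
      constructor <;> ring
    | succ n ih =>
      refine ⟨ih.2, ?_⟩
      have e0 := hrec n
      have e1 := hrec (n + 1)
      have e2 := hrec (n + 2)
      have e3 := hrec (n + 3)
      have e4 := hrec (n + 4)
      push_cast at e1 e2 e3 e4
      have hn : ((n : ℝ) + 6) ≠ 0 := by positivity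
      refine (mul_right_inj' hn).1 ?_
      obtain ⟨i1, i2⟩ := ih
      simp only [add_assoc, Nat.reduceAdd, Nat.add_comm 1] at *
      -- The multipliers of the recurrences are the coefficients of `D²`.
      linear_combination e4 - 4 * a * e3 + (2 + 4 * a ^ 2) * e2 - 4 * a * e1 + e0
        + 2 * a * (n + 5) * i2 - (n + 4) * i1
  set F := ∑' k, c k * t ^ k with hF
  have hsum : ∀ n, HasSum (fun k => c (k + n) * t ^ (k + n))
      (F - ∑ k ∈ Finset.range n, c k * t ^ k) := fun n =>
    (hasSum_nat_add_iff' n).2 hs.hasSum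
  have hcomb := ((((hsum 4).add ((hsum 3).mul_left (-4 * a * t))).add
    ((hsum 2).mul_left ((2 + 4 * a ^ 2) * t ^ 2))).add ((hsum 1).mul_left (-4 * a * t ^ 3))).add
    ((hsum 0).mul_left (t ^ 4))
  have hzero : (fun k => c (k + 4) * t ^ (k + 4) + -4 * a * t * (c (k + 3) * t ^ (k + 3)) +
      (2 + 4 * a ^ 2) * t ^ 2 * (c (k + 2) * t ^ (k + 2)) +
      -4 * a * t ^ 3 * (c (k + 1) * t ^ (k + 1)) + t ^ 4 * (c (k + 0) * t ^ (k + 0))) =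
      fun _ => 0 := by
    funext k
    have := (hE k).1
    simp only [add_zero]
    linear_combination t ^ (k + 4) * this
  rw [hzero] at hcomb
  have h := hcomb.unique hasSum_zero
  simp only [Finset.sum_range_succ, Finset.sum_range_zero, h0, h1, h2, h3] at h
  have : F = ((1 - 2 * a * t + t ^ 2) ^ 2)⁻¹ := by
    refine eq_inv_of_mul_eq_one_left ?_
    linear_combination h
  rw [← this]
  exact hs.hasSum

/-! ### Orthogonal invariance -/

/-- The polynomial `x ↦ p (g x)`. -/
def polyComp (g : E6 ≃ₗᵢ[ℝ] E6) (p : MvPolynomial (Fin 6) ℝ) : MvPolynomial (Fin 6) ℝ :=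
  MvPolynomial.aeval (fun i => ∑ j, MvPolynomial.C (g (EuclideanSpace.single j 1) i) *
    MvPolynomial.X j) p

lemma polyEval_polyComp (g : E6 ≃ₗᵢ[ℝ] E6) (p : MvPolynomial (Fin 6) ℝ) (x : E6) :
    polyEval (polyComp g p) x = polyEval p (g x) := by
  have hg : ∀ i, g x i = ∑ j, g (EuclideanSpace.single j 1) i * x j := by
    intro i
    have hx : x = ∑ j, x j • (EuclideanSpace.single j 1 : E6) := by
      ext i
      simp [Finset.sum_apply, Pi.single_apply]
    conv_lhs => rw [hx, map_sum]
    simp [mul_comm]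
  unfold polyEval polyComp
  induction p using MvPolynomial.induction_on with
  | C a => simp
  | add p q hp hq => simp only [map_add, hp, hq]
  | mul_X p i hp =>
    rw [map_mul, map_mul, hp, map_mul, MvPolynomial.aeval_X, MvPolynomial.eval_X, hg i]
    simp only [map_sum, map_mul, MvPolynomial.eval_C, MvPolynomial.eval_X]

lemma pderiv_polyComp (g : E6 ≃ₗᵢ[ℝ] E6) (p : MvPolynomial (Fin 6) ℝ) (j : Fin 6) :
    MvPolynomial.pderiv j (polyComp g p) =
      ∑ i, MvPolynomial.C (g (EuclideanSpace.single j 1) i) *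
        polyComp g (MvPolynomial.pderiv i p) := by
  induction p using MvPolynomial.induction_on with
  | C a => simp [polyComp]
  | add p q hp hq =>
    simp only [polyComp, map_add, mul_add, Finset.sum_add_distrib] at *
    rw [hp, hq]
  | mul_X p m hp =>
    simp only [polyComp, map_mul, MvPolynomial.aeval_X, MvPolynomial.pderiv_mul,
      MvPolynomial.pderiv_X] at *
    rw [hp]
    simp only [map_sum, map_add, map_mul, MvPolynomial.aeval_X, MvPolynomial.pderiv_C_mul,
      MvPolynomial.pderiv_X, Pi.single_apply, mul_add, Finset.sum_add_distrib]
    congr 1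
    · rw [Finset.sum_mul]
      exact Finset.sum_congr rfl fun i _ => by ring
    · simp
      ring

/-- The rows of the matrix of `g` are orthonormal: they are the images of the standard basis under
`g⁻¹`. -/
lemma sum_orthogonal (g : E6 ≃ₗᵢ[ℝ] E6) (i m : Fin 6) :
    ∑ j, g (EuclideanSpace.single j 1) i * g (EuclideanSpace.single j 1) m =
      if i = m then 1 else 0 := by
  have h : ∀ i j, g (EuclideanSpace.single j 1) i = g.symm (EuclideanSpace.single i 1) j := by
    intro i j
    have h1 := g.inner_map_map (EuclideanSpace.single j 1) (g.symm (EuclideanSpace.single i 1))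
    rw [LinearIsometryEquiv.apply_symm_apply] at h1
    simpa [EuclideanSpace.inner_single_left, EuclideanSpace.inner_single_right] using h1
  have h2 := g.symm.inner_map_map (EuclideanSpace.single m 1) (EuclideanSpace.single i 1)
  rw [PiLp.inner_apply] at h2
  simp only [h]
  simpa [EuclideanSpace.inner_single_left, PiLp.single_apply, eq_comm] using h2

lemma polyLaplacian_polyComp (g : E6 ≃ₗᵢ[ℝ] E6) (p : MvPolynomial (Fin 6) ℝ) :
    polyLaplacian (polyComp g p) = polyComp g (polyLaplacian p) := by
  simp only [polyLaplacian_apply, pderiv_polyComp, map_sum, MvPolynomial.pderiv_C_mul]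
  have h : ∀ i m : Fin 6, ∑ j, MvPolynomial.C (g (EuclideanSpace.single j 1) i) *
      (MvPolynomial.C (g (EuclideanSpace.single j 1) m) *
        polyComp g (MvPolynomial.pderiv m (MvPolynomial.pderiv i p))) =
      if i = m then polyComp g (MvPolynomial.pderiv m (MvPolynomial.pderiv i p)) else 0 := by
    intro i m
    simp only [← mul_assoc, ← map_mul, ← Finset.sum_mul, ← map_sum, sum_orthogonal]
    split_ifs <;> simp
  simp only [Finset.mul_sum]
  rw [Finset.sum_comm]
  calc _ = ∑ i, ∑ m, ∑ j, MvPolynomial.C (g (EuclideanSpace.single j 1) i) *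
      (MvPolynomial.C (g (EuclideanSpace.single j 1) m) *
        polyComp g (MvPolynomial.pderiv m (MvPolynomial.pderiv i p))) :=
        Finset.sum_congr rfl fun i _ => Finset.sum_comm
    _ = _ := by
      simp only [h]
      simp [polyComp]

lemma IsSolidHarmonic.polyComp {k : ℕ} {p : MvPolynomial (Fin 6) ℝ} (hp : IsSolidHarmonic k p)
    (g : E6 ≃ₗᵢ[ℝ] E6) : IsSolidHarmonic k (polyComp g p) := by
  constructor
  · have := hp.1.aeval (S := ℝ) (fun i => ∑ j, MvPolynomial.C (g (EuclideanSpace.single j 1) i) *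
      MvPolynomial.X j) (n := 1) (fun i => MvPolynomial.IsHomogeneous.sum _ _ _ fun j _ =>
        MvPolynomial.isHomogeneous_C_mul_X _ _)
    rwa [one_mul] at this
  · rw [polyLaplacian_polyComp, hp.2, NewtonHarmonic.polyComp, map_zero]

/-- The action of a linear isometry on the sphere. -/
def sphereMap (g : E6 ≃ₗᵢ[ℝ] E6) (ξ : S5) : S5 := ⟨g ξ, by simp⟩

lemma continuous_sphereMap (g : E6 ≃ₗᵢ[ℝ] E6) : Continuous (sphereMap g) := by
  unfold sphereMap
  fun_prop

open scoped Pointwise in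
lemma measurePreserving_sphereMap (g : E6 ≃ₗᵢ[ℝ] E6) :
    MeasurePreserving (sphereMap g) surfaceMeasure surfaceMeasure := by
  refine ⟨(continuous_sphereMap g).measurable, ?_⟩
  ext s hs
  rw [Measure.map_apply (continuous_sphereMap g).measurable hs, surfaceMeasure,
    Measure.toSphere_apply' _ hs,
    Measure.toSphere_apply' _ ((continuous_sphereMap g).measurable hs)]
  congr 1
  have : Set.Ioo (0 : ℝ) 1 • (Subtype.val '' (sphereMap g ⁻¹' s)) =
      g ⁻¹' (Set.Ioo (0 : ℝ) 1 • (Subtype.val '' s)) := by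
    ext x
    simp only [Set.mem_smul, Set.mem_image, Set.mem_preimage]
    constructor
    · rintro ⟨r, hr, _, ⟨ξ, hξ, rfl⟩, rfl⟩
      exact ⟨r, hr, _, ⟨_, hξ, rfl⟩, by simp [sphereMap]⟩
    · rintro ⟨r, hr, _, ⟨ξ, hξ, rfl⟩, h⟩
      refine ⟨r, hr, _, ⟨sphereMap g.symm ξ, ?_, rfl⟩, ?_⟩
      · convert hξ
        ext1
        simp [sphereMap]
      · apply g.injective
        simp [sphereMap, h]
  rw [this]
  exact (g.measurePreserving).measure_preimage_equiv (f := g.toHomeomorph.toMeasurableEquiv) _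

instance : IsFiniteMeasure surfaceMeasure := by
  unfold surfaceMeasure; infer_instance

lemma surfaceMeasure_univ : surfaceMeasure.real Set.univ = π ^ 3 := by
  rw [surfaceMeasure, Measure.toSphere_real_apply_univ, measureReal_def,
    InnerProductSpace.volume_ball_of_dim_even (k := 3) (by simp)]
  have h : (0 : ℝ) ≤ π ^ 3 / (Nat.factorial 3 : ℝ) := by positivity
  simp only [ENNReal.ofReal_one, one_pow, one_mul, ENNReal.toReal_ofReal h,
    finrank_euclideanSpace, Fintype.card_fin]
  norm_num [Nat.factorial]
  ring

lemma mem_sphericalHarmonics {k : ℕ} {F : S5 → ℝ} :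
    F ∈ sphericalHarmonics k ↔ ∃ p, IsSolidHarmonic k p ∧ ∀ ξ : S5, F ξ = polyEval p ξ := by
  simp only [sphericalHarmonics, Submodule.mem_map, Submodule.mem_inf, LinearMap.mem_ker,
    MvPolynomial.mem_homogeneousSubmodule, IsSolidHarmonic]
  refine exists_congr fun p => and_congr_right fun _ => ?_
  rw [funext_iff]
  refine forall_congr' fun ξ => ?_
  rw [eq_comm, polyEval, ← MvPolynomial.coe_aeval_eq_eval]
  rfl

lemma comp_sphereMap_mem {k : ℕ} {F : S5 → ℝ} (hF : F ∈ sphericalHarmonics k)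
    (g : E6 ≃ₗᵢ[ℝ] E6) : F ∘ sphereMap g ∈ sphericalHarmonics k := by
  obtain ⟨p, hp, h⟩ := mem_sphericalHarmonics.1 hF
  refine mem_sphericalHarmonics.2 ⟨polyComp g p, hp.polyComp g, fun ξ => ?_⟩
  rw [polyEval_polyComp, Function.comp_apply, h]
  rfl

lemma continuous_of_mem {k : ℕ} {F : S5 → ℝ} (hF : F ∈ sphericalHarmonics k) : Continuous F := by
  obtain ⟨p, -, h⟩ := mem_sphericalHarmonics.1 hF
  rw [funext h]
  exact (continuous_polyEval p).comp continuous_subtype_val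

lemma integrable_of_continuous {F : S5 → ℝ} (hF : Continuous F) : Integrable F surfaceMeasure :=
  hF.integrable_of_hasCompactSupport (HasCompactSupport.of_compactSpace F)

/-! ### The reproducing kernel of the spherical harmonics -/

variable {Y : (k : ℕ) → Fin (harmonicDim k) → S5 → ℝ}

/-- The kernel `∑ⱼ Y_{k,j}(ξ) Y_{k,j}(η)`. -/
def reproducingKernel (Y : (k : ℕ) → Fin (harmonicDim k) → S5 → ℝ) (k : ℕ) (ξ η : S5) : ℝ :=
  ∑ j, Y k j ξ * Y k j η

lemma reproducingKernel_comm (k : ℕ) (ξ η : S5) :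
    reproducingKernel Y k ξ η = reproducingKernel Y k η ξ :=
  Finset.sum_congr rfl fun _ _ => mul_comm _ _

namespace IsHarmonicBasis

lemma mem (hY : IsHarmonicBasis Y) (k : ℕ) (j : Fin (harmonicDim k)) :
    Y k j ∈ sphericalHarmonics k := by
  rw [← hY.span_eq k]
  exact Submodule.subset_span ⟨j, rfl⟩

lemma continuous (hY : IsHarmonicBasis Y) (k : ℕ) (j : Fin (harmonicDim k)) :
    Continuous (Y k j) := continuous_of_mem (hY.mem k j)

lemma continuous_reproducingKernel (hY : IsHarmonicBasis Y) (k : ℕ) (η : S5) :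
    Continuous fun ξ => reproducingKernel Y k ξ η := by
  unfold reproducingKernel
  exact continuous_finsetSum _ fun j _ => (hY.continuous k j).mul continuous_const

lemma reproducingKernel_mem (hY : IsHarmonicBasis Y) (k : ℕ) (η : S5) :
    (fun ξ => reproducingKernel Y k ξ η) ∈ sphericalHarmonics k := by
  have : (fun ξ => reproducingKernel Y k ξ η) = ∑ j, Y k j η • Y k j := by
    funext ξ
    simp [reproducingKernel, Finset.sum_apply, mul_comm]
  rw [this]
  exact Submodule.sum_mem _ fun j _ => Submodule.smul_mem _ _ (hY.mem k j)

/-- The reproducing property. -/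
lemma integral_reproducingKernel_mul (hY : IsHarmonicBasis Y) {k : ℕ} {F : S5 → ℝ}
    (hF : F ∈ sphericalHarmonics k) (η : S5) :
    ∫ ξ, reproducingKernel Y k ξ η * F ξ ∂surfaceMeasure = π ^ 3 * F η := by
  rw [← hY.span_eq k, Submodule.mem_span_range_iff_exists_fun] at hF
  obtain ⟨c, rfl⟩ := hF
  have h : ∀ ξ, reproducingKernel Y k ξ η * (∑ i, c i • Y k i) ξ =
      ∑ j, ∑ i, c i * Y k j η * (Y k j ξ * Y k i ξ) := by
    intro ξ
    simp only [reproducingKernel, Finset.sum_apply, Pi.smul_apply, smul_eq_mul, Finset.sum_mul_sum]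
    exact Finset.sum_congr rfl fun j _ => Finset.sum_congr rfl fun i _ => by ring
  have hint : ∀ i j, Integrable (fun ξ => c i * Y k j η * (Y k j ξ * Y k i ξ)) surfaceMeasure :=
    fun i j => integrable_of_continuous
      (continuous_const.mul ((hY.continuous k j).mul (hY.continuous k i)))
  simp only [h]
  rw [integral_finsetSum _ fun j _ => integrable_finsetSum _ fun i _ => hint i j]
  simp only [integral_finsetSum _ fun i _ => hint i _, integral_const_mul, hY.integral_mul]
  simp [Finset.sum_apply, Finset.mul_sum]
  exact Finset.sum_congr rfl fun j _ => by ring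

/-- The reproducing property characterizes the kernel among spherical harmonics. -/
lemma reproducingKernel_unique (hY : IsHarmonicBasis Y) {k : ℕ} {G : S5 → ℝ}
    (hG : G ∈ sphericalHarmonics k) (η : S5)
    (h : ∀ F ∈ sphericalHarmonics k, ∫ ξ, G ξ * F ξ ∂surfaceMeasure = π ^ 3 * F η) (ζ : S5) :
    G ζ = reproducingKernel Y k ζ η := by
  have h1 := h _ (hY.reproducingKernel_mem k ζ)
  have h2 := hY.integral_reproducingKernel_mul hG ζ
  simp only [mul_comm (G _)] at h1
  rw [h1] at h2
  rw [reproducingKernel_comm k ζ η]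
  exact (mul_left_cancel₀ (by positivity) h2).symm

/-- Orthogonal invariance, from the invariance of the measure and of the spherical harmonics. -/
lemma reproducingKernel_sphereMap (hY : IsHarmonicBasis Y) (k : ℕ) (g : E6 ≃ₗᵢ[ℝ] E6) (ξ η : S5) :
    reproducingKernel Y k (sphereMap g ξ) (sphereMap g η) = reproducingKernel Y k ξ η := by
  refine hY.reproducingKernel_unique
    (G := (fun ξ => reproducingKernel Y k ξ (sphereMap g η)) ∘ sphereMap g)
    (comp_sphereMap_mem (hY.reproducingKernel_mem k _) g) η (fun F hF => ?_) ξ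
  have hinv : ∀ ξ, sphereMap g.symm (sphereMap g ξ) = ξ := fun ξ => by ext1; simp [sphereMap]
  have hF' := comp_sphereMap_mem hF g.symm
  have h := hY.integral_reproducingKernel_mul hF' (sphereMap g η)
  have hcont : Continuous fun ξ => reproducingKernel Y k ξ (sphereMap g η) *
      (F ∘ sphereMap g.symm) ξ :=
    (hY.continuous_reproducingKernel k _).mul (continuous_of_mem hF')
  have := (measurePreserving_sphereMap g).integral_comp
    (Homeomorph.measurableEmbedding ⟨⟨sphereMap g, sphereMap g.symm, hinv,
      fun ξ => by ext1; simp [sphereMap]⟩, continuous_sphereMap g, continuous_sphereMap g.symm⟩)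
    (fun ξ => reproducingKernel Y k ξ (sphereMap g η) * (F ∘ sphereMap g.symm) ξ)
  rw [h] at this
  simpa [hinv] using this

end IsHarmonicBasis

/-- Any two points of the sphere are exchanged by a reflection, which fixes every point with the
same inner product with both. -/
lemma exists_reflection (ξ η : S5) : ∃ g : E6 ≃ₗᵢ[ℝ] E6, sphereMap g ξ = η ∧
    ∀ ζ : S5, inner ℝ (ζ : E6) (ξ : E6) = inner ℝ (ζ : E6) (η : E6) → sphereMap g ζ = ζ := by
  refine ⟨(ℝ ∙ ((ξ : E6) - η))ᗮ.reflection, ?_, fun ζ hζ => ?_⟩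
  · ext1
    exact Submodule.reflection_sub (by simp)
  · ext1
    refine Submodule.reflection_mem_subspace_eq_self ?_
    rw [Submodule.mem_orthogonal_singleton_iff_inner_left, inner_sub_right, hζ, sub_self]

/-- The pole as a point of the sphere. -/
def spherePole : S5 := ⟨pole, by simp [norm_pole]⟩

namespace IsHarmonicBasis

/-- The kernel is constant on the diagonal, where its integral is `π³` times the dimension. -/
lemma reproducingKernel_self (hY : IsHarmonicBasis Y) (k : ℕ) (ξ : S5) :
    reproducingKernel Y k ξ ξ = harmonicDim k := by
  have hconst : ∀ η, reproducingKernel Y k η η = reproducingKernel Y k ξ ξ := by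
    intro η
    obtain ⟨g, hg, -⟩ := exists_reflection ξ η
    rw [← hg, hY.reproducingKernel_sphereMap]
  have h1 : ∫ η, reproducingKernel Y k η η ∂surfaceMeasure = π ^ 3 * harmonicDim k := by
    unfold reproducingKernel
    rw [integral_finsetSum (f := fun j η => Y k j η * Y k j η) _ fun j _ =>
      integrable_of_continuous ((hY.continuous k j).mul (hY.continuous k j))]
    simp [hY.integral_mul, mul_comm]
  simp only [hconst, integral_const, smul_eq_mul, surfaceMeasure_univ] at h1
  exact mul_left_cancel₀ (by positivity) h1

lemma abs_reproducingKernel_le (hY : IsHarmonicBasis Y) (k : ℕ) (ξ η : S5) :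
    |reproducingKernel Y k ξ η| ≤ harmonicDim k := by
  refine abs_le_of_sq_le_sq ?_ (by positivity)
  have h := Finset.sum_mul_sq_le_sq_mul_sq Finset.univ (fun j => Y k j ξ) (fun j => Y k j η)
  have h1 := hY.reproducingKernel_self k ξ
  have h2 := hY.reproducingKernel_self k η
  simp only [reproducingKernel, ← pow_two] at h1 h2
  rwa [h1, h2, ← pow_two] at h

end IsHarmonicBasis

/-! ### The expansion of the Newtonian kernel -/

lemma harmonicDim_eq (k : ℕ) :
    (harmonicDim k : ℝ) = (k + 1) * (k + 2) ^ 2 * (k + 3) / 12 := by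
  match k with
  | 0 => norm_num [harmonicDim]
  | 1 => norm_num [harmonicDim]
  | n + 2 =>
    have h : harmonicDim (n + 2) = (n + 2 + 5).choose (n + 2) - (n + 5).choose n := by
      simp [harmonicDim]
    have hle : (n + 5).choose n ≤ (n + 2 + 5).choose (n + 2) := by
      rw [Nat.choose_symm_add, Nat.choose_symm_add]
      exact Nat.choose_le_choose 5 (by omega)
    have h1 : ((n + 2).factorial : ℝ) = (n + 2) * (n + 1) * n.factorial := by
      push_cast [Nat.factorial_succ]; ring
    have h2 : ((n + 5).factorial : ℝ) =
        (n + 5) * (n + 4) * (n + 3) * (n + 2) * (n + 1) * n.factorial := by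
      push_cast [Nat.factorial_succ]; ring
    have h3 : ((n + 2 + 5).factorial : ℝ) = (n + 7) * (n + 6) * (n + 5).factorial := by
      rw [show n + 2 + 5 = n + 5 + 1 + 1 by ring]
      push_cast [Nat.factorial_succ]; ring
    have hn : (n.factorial : ℝ) ≠ 0 := by positivity
    rw [h, Nat.cast_sub hle, Nat.cast_add_choose, Nat.cast_add_choose, h3, h2, h1]
    have h5 : ((5).factorial : ℝ) = 120 := by norm_num [Nat.factorial]
    rw [h5]
    push_cast
    field_simp
    ring

lemma inner_pole (x : E6) : inner ℝ pole x = x 0 := by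
  simp [pole, EuclideanSpace.inner_single_left]

lemma exists_smul_sphere {x : E6} (hx : x ≠ 0) : ∃ ξ : S5, x = ‖x‖ • (ξ : E6) :=
  ⟨direction x hx, by
    rw [direction, smul_smul, mul_inv_cancel₀ (norm_ne_zero_iff.2 hx), one_smul]⟩

namespace IsHarmonicBasis

/-- The reproducing kernels with one argument at the pole form a Gegenbauer family. They are zonal
because the reflections which fix the pole act transitively on its parallels. -/
lemma exists_gegenbauerFamily (hY : IsHarmonicBasis Y) :
    ∃ q, IsGegenbauerFamily q ∧ ∀ (k : ℕ) (ξ : S5),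
      polyEval (q k) ξ = 2 / (k + 2) * reproducingKernel Y k ξ spherePole := by
  choose p hp hpR using fun k => mem_sphericalHarmonics.1 (hY.reproducingKernel_mem k spherePole)
  refine ⟨fun k => (2 / (k + 2) : ℝ) • p k, ⟨fun k => (hp k).smul _, fun k => IsZonal.smul ?_ _,
    fun k => ?_⟩, fun k ξ => by rw [polyEval_smul_poly, hpR]⟩
  · intro x y hxy h0
    rcases eq_or_ne x 0 with rfl | hx
    · rw [norm_zero, eq_comm, norm_eq_zero] at hxy
      rw [hxy]
    have hy : y ≠ 0 := by
      rw [← norm_ne_zero_iff, ← hxy]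
      exact norm_ne_zero_iff.2 hx
    have hr : ‖x‖ ≠ 0 := norm_ne_zero_iff.2 hx
    obtain ⟨ξ, hξ⟩ := exists_smul_sphere hx
    obtain ⟨η, hη⟩ := exists_smul_sphere hy
    rw [← hxy] at hη
    have h0' : (ξ : E6) 0 = (η : E6) 0 := by
      rw [hξ, hη] at h0
      simpa [norm_smul, hx] using h0
    obtain ⟨g, hg, hfix⟩ := exists_reflection ξ η
    have hpole : sphereMap g spherePole = spherePole :=
      hfix _ (by rw [spherePole, inner_pole, inner_pole, h0'])
    rw [hξ, hη, polyEval_smul (hp k).1, polyEval_smul (hp k).1, ← hpR, ← hpR, ← hg]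
    congr 1
    rw [← hY.reproducingKernel_sphereMap k g ξ, hpole]
  · have : polyEval (p k) pole = harmonicDim k := by
      rw [← hY.reproducingKernel_self k spherePole, hpR]
      rfl
    rw [polyEval_smul_poly, this, harmonicDim_eq]
    field_simp
    ring

lemma summable_harmonicDim_mul_pow {t : ℝ} (ht : |t| < 1) :
    Summable fun k : ℕ => (harmonicDim k : ℝ) * t ^ k := by
  have h : ∀ n : ℕ, Summable fun k : ℕ => (k : ℝ) ^ n * t ^ k := fun n =>
    summable_pow_mul_geometric_of_norm_lt_one n (by rwa [Real.norm_eq_abs])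
  refine ((((((h 4).add ((h 3).mul_left 8)).add ((h 2).mul_left 23)).add
    ((h 1).mul_left 28)).add ((h 0).mul_left 12)).mul_left (1 / 12)).congr fun k => ?_
  rw [harmonicDim_eq]
  ring

lemma abs_two_div_mul_le (hY : IsHarmonicBasis Y) (k : ℕ) (ξ η : S5) :
    |2 / (k + 2) * reproducingKernel Y k ξ η| ≤ harmonicDim k := by
  rw [abs_mul]
  have h1 : |(2 / (k + 2) : ℝ)| ≤ 1 := by
    rw [abs_of_nonneg (by positivity), div_le_one (by positivity)]
    linarith [(Nat.cast_nonneg k : (0 : ℝ) ≤ k)]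
  calc _ ≤ 1 * (harmonicDim k : ℝ) :=
        mul_le_mul h1 (hY.abs_reproducingKernel_le k ξ η) (abs_nonneg _) zero_le_one
    _ = _ := one_mul _

/-- The addition theorem, in the form of a generating function. -/
theorem hasSum_reproducingKernel (hY : IsHarmonicBasis Y) (ξ η : S5) {t : ℝ} (ht : |t| < 1) :
    HasSum (fun k : ℕ => 2 / (k + 2) * reproducingKernel Y k ξ η * t ^ k)
      (((1 - 2 * inner ℝ (ξ : E6) (η : E6) * t + t ^ 2) ^ 2)⁻¹) := by
  obtain ⟨q, hq, hqR⟩ := hY.exists_gegenbauerFamily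
  obtain ⟨g, hg, -⟩ := exists_reflection η spherePole
  have hval : ∀ k : ℕ, 2 / (k + 2) * reproducingKernel Y k ξ η =
      polyEval (q k) (sphereMap g ξ) := fun k => by
    rw [hqR, ← hY.reproducingKernel_sphereMap k g, hg]
  have ha : inner ℝ (ξ : E6) (η : E6) = (sphereMap g ξ : E6) 0 := by
    rw [← inner_pole, real_inner_comm, ← g.inner_map_map]
    have : g (η : E6) = pole := congrArg Subtype.val hg
    rw [this]
    rfl
  refine hasSum_gegenbauer ?_ ?_ (fun k => ?_) ?_
  · rw [hval, hq.zero]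
    simp [polyEval]
  · rw [hval, hq.one, polyEval_smul_poly, polyEval_X, ha]
  · have h := congrArg (fun p => polyEval p (sphereMap g ξ)) (hq.recurrence k)
    simp only [polyEval_add, polyEval_smul_poly, polyEval_mul, polyEval_X, polyEval_normSqPoly,
      norm_eq_of_mem_sphere, ← hval] at h
    rw [ha]
    linear_combination h
  · refine Summable.of_norm_bounded (summable_harmonicDim_mul_pow (t := |t|) (by rwa [abs_abs]))
      fun k => ?_
    rw [norm_mul, norm_pow, Real.norm_eq_abs, Real.norm_eq_abs]
    gcongr
    exact hY.abs_two_div_mul_le k ξ η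

end IsHarmonicBasis

/-- The radial part `min(s, ρ)^k / max(s, ρ)^(k+4)` of the term of degree `k` in the expansion of
the Newtonian kernel. -/
def radialFactor (k : ℕ) (s ρ : ℝ) : ℝ := min s ρ ^ k / max s ρ ^ (k + 4)

lemma radialFactor_eq {s ρ : ℝ} (hρ : 0 < ρ) (k : ℕ) :
    radialFactor k s ρ = (min s ρ / max s ρ) ^ k / max s ρ ^ 4 := by
  have : 0 < max s ρ := lt_max_of_lt_right hρ
  rw [radialFactor, div_pow, div_div, pow_add]

lemma radialFactor_nonneg {s ρ : ℝ} (hs : 0 ≤ s) (hρ : 0 < ρ) (k : ℕ) :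
    0 ≤ radialFactor k s ρ :=
  div_nonneg (pow_nonneg (le_min hs hρ.le) _) (pow_nonneg (le_max_of_le_left hs) _)

/-- The expansion of the Newtonian kernel away from the diagonal radius. -/
theorem IsHarmonicBasis.hasSum_newton (hY : IsHarmonicBasis Y) (ξ η : S5) {s ρ : ℝ} (hs : 0 ≤ s)
    (hρ : 0 < ρ) (hne : s ≠ ρ) :
    HasSum (fun k : ℕ => 2 / (k + 2) * reproducingKernel Y k ξ η * radialFactor k s ρ)
      (1 / ‖ρ • (ξ : E6) - s • (η : E6)‖ ^ 4) := by
  have hM : 0 < max s ρ := lt_max_of_lt_right hρ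
  have hm : 0 ≤ min s ρ := le_min hs hρ.le
  have hlt : min s ρ < max s ρ := min_lt_max.2 hne
  have ht : |min s ρ / max s ρ| < 1 := by
    rw [abs_of_nonneg (by positivity), div_lt_one hM]
    exact hlt
  have h := (hY.hasSum_reproducingKernel ξ η ht).mul_right (1 / max s ρ ^ 4)
  have hnorm : ‖ρ • (ξ : E6) - s • (η : E6)‖ ^ 2 =
      max s ρ ^ 2 * (1 - 2 * inner ℝ (ξ : E6) (η : E6) * (min s ρ / max s ρ) +
        (min s ρ / max s ρ) ^ 2) := by
    rw [norm_sub_sq_real, norm_smul, norm_smul, norm_eq_of_mem_sphere, norm_eq_of_mem_sphere,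
      inner_smul_left, inner_smul_right]
    simp only [mul_one, Real.norm_eq_abs, sq_abs, conj_trivial]
    have h1 : min s ρ * max s ρ = s * ρ := min_mul_max s ρ
    have h2 : min s ρ + max s ρ = s + ρ := min_add_max s ρ
    have h3 : min s ρ ^ 2 + max s ρ ^ 2 = s ^ 2 + ρ ^ 2 := by
      linear_combination (min s ρ + max s ρ + s + ρ) * h2 - 2 * h1
    field_simp
    linear_combination 2 * inner ℝ (ξ : E6) (η : E6) * h1 - h3
  have hf : (fun k : ℕ => 2 / (k + 2) * reproducingKernel Y k ξ η * radialFactor k s ρ) =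
      fun k : ℕ => 2 / (k + 2) * reproducingKernel Y k ξ η * (min s ρ / max s ρ) ^ k *
        (1 / max s ρ ^ 4) := by
    funext k
    rw [radialFactor_eq hρ]
    ring
  have hv : 1 / ‖ρ • (ξ : E6) - s • (η : E6)‖ ^ 4 =
      ((1 - 2 * inner ℝ (ξ : E6) (η : E6) * (min s ρ / max s ρ) +
        (min s ρ / max s ρ) ^ 2) ^ 2)⁻¹ * (1 / max s ρ ^ 4) := by
    rw [show 4 = 2 * 2 from rfl, pow_mul, pow_mul, hnorm, mul_pow, one_div, mul_inv, one_div]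
    ring
  rw [hf, hv]
  exact h

/-! ### Polar coordinates -/

/-- Polar coordinates on `ℝ⁶ ∖ {0}`. -/
def polarMap (p : S5 × Set.Ioi (0 : ℝ)) : E6 := (p.2 : ℝ) • (p.1 : E6)

lemma polarMap_eq : polarMap = Subtype.val ∘ (homeomorphUnitSphereProd E6).symm := by
  funext p
  simp [polarMap]

lemma measurableEmbedding_polarMap : MeasurableEmbedding polarMap := by
  rw [polarMap_eq]
  exact (MeasurableEmbedding.subtype_coe (measurableSet_singleton _).compl).comp
    (Homeomorph.measurableEmbedding _)

lemma measurePreserving_polarMap :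
    MeasurePreserving polarMap (surfaceMeasure.prod (Measure.volumeIoiPow 5)) volume := by
  have h := (volume : Measure E6).measurePreserving_homeomorphUnitSphereProd
  rw [finrank_euclideanSpace, Fintype.card_fin] at h
  have h1 := MeasurePreserving.symm (homeomorphUnitSphereProd E6).toMeasurableEquiv h
  have h2 := measurePreserving_subtype_coe (μa := (volume : Measure E6))
    (measurableSet_singleton (0 : E6)).compl
  rw [restrict_compl_singleton] at h2
  rw [polarMap_eq]
  exact h2.comp h1

lemma integrable_volumeIoiPow_iff (n : ℕ) (g : ℝ → ℝ) :
    Integrable (fun r : Set.Ioi (0 : ℝ) => g r) (Measure.volumeIoiPow n) ↔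
      IntegrableOn (fun r => r ^ n * g r) (Set.Ioi 0) := by
  rw [integrableOn_iff_comap_subtypeVal measurableSet_Ioi, Measure.volumeIoiPow,
    integrable_withDensity_iff_integrable_smul' (by fun_prop) (by simp)]
  refine integrable_congr (.of_forall ?_)
  rintro ⟨x, hx : 0 < x⟩
  simp [ENNReal.toReal_ofReal (pow_nonneg hx.le n)]

lemma integral_volumeIoiPow (n : ℕ) (g : ℝ → ℝ) :
    ∫ r : Set.Ioi (0 : ℝ), g r ∂(Measure.volumeIoiPow n) = ∫ r in Set.Ioi 0, r ^ n * g r := by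
  simp only [Measure.volumeIoiPow, ENNReal.ofReal]
  rw [integral_withDensity_eq_integral_smul (by fun_prop),
    integral_subtype_comap measurableSet_Ioi fun a : ℝ => Real.toNNReal (a ^ n) • g a]
  refine setIntegral_congr_fun measurableSet_Ioi fun x hx => ?_
  simp only [NNReal.smul_def, smul_eq_mul]
  rw [Real.coe_toNNReal _ (pow_nonneg (le_of_lt hx) _)]

/-- The direction of a vector, with an arbitrary value at the origin. -/
def unitDir (y : E6) : S5 := if h : y = 0 then spherePole else direction y h

lemma norm_smul_unitDir (y : E6) : ‖y‖ • (unitDir y : E6) = y := by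
  by_cases h : y = 0
  · simp [h]
  · rw [unitDir, dif_neg h, direction, smul_smul, mul_inv_cancel₀ (norm_ne_zero_iff.2 h), one_smul]

lemma norm_polarMap (p : S5 × Set.Ioi (0 : ℝ)) : ‖polarMap p‖ = p.2 := by
  simp [polarMap, norm_smul, abs_of_pos (Set.mem_Ioi.1 p.2.2)]

lemma unitDir_polarMap (p : S5 × Set.Ioi (0 : ℝ)) : unitDir (polarMap p) = p.1 := by
  have h0 : (p.2 : ℝ) ≠ 0 := (Set.mem_Ioi.1 p.2.2).ne'
  have h := norm_smul_unitDir (polarMap p)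
  rw [norm_polarMap] at h
  ext1
  exact smul_right_injective E6 h0 h

lemma measurable_unitDir : Measurable unitDir := by
  refine Measurable.subtype_mk (f := fun y => (unitDir y : E6)) ?_ (h := fun y => (unitDir y).2)
  have : (fun y => (unitDir y : E6)) = fun y => if y = 0 then pole else ‖y‖⁻¹ • y := by
    funext y
    by_cases h : y = 0
    · simp [unitDir, h, spherePole]
    · simp [unitDir, h, direction]
  rw [this]
  exact Measurable.ite (measurableSet_singleton 0) measurable_const (by fun_prop)

/-! ### Square integrals of the radial factors -/

lemma integral_radialFactor_sq (k : ℕ) {ρ : ℝ} (hρ : 0 < ρ) :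
    IntegrableOn (fun r => r ^ 5 * radialFactor k r ρ ^ 2) (Set.Ioi 0) ∧
      ∫ r in Set.Ioi 0, r ^ 5 * radialFactor k r ρ ^ 2 =
        (ρ ^ 2)⁻¹ * (1 / (2 * k + 6) + 1 / (2 * k + 2)) := by
  have e1 : Set.EqOn (fun r => r ^ 5 * radialFactor k r ρ ^ 2)
      (fun r => r ^ (2 * k + 5) * (ρ ^ (2 * k + 8))⁻¹) (Set.Ioc 0 ρ) := by
    intro r hr
    simp only [radialFactor, min_eq_left hr.2, max_eq_right hr.2]
    rw [div_pow, ← pow_mul, ← pow_mul, div_eq_mul_inv]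
    ring
  have e2 : Set.EqOn (fun r => r ^ 5 * radialFactor k r ρ ^ 2)
      (fun r => ρ ^ (2 * k) * r ^ (-(2 * k + 3) : ℝ)) (Set.Ioi ρ) := by
    intro r hr
    have hr' : ρ < r := hr
    have h0 : 0 < r := hρ.trans hr'
    simp only [radialFactor, min_eq_right hr'.le, max_eq_left hr'.le]
    rw [rpow_neg h0.le, show (2 * k + 3 : ℝ) = ((2 * k + 3 : ℕ) : ℝ) by push_cast; ring,
      rpow_natCast, div_pow]
    field_simp
    ring
  have i1 : IntegrableOn (fun r => r ^ 5 * radialFactor k r ρ ^ 2) (Set.Ioc 0 ρ) := by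
    refine IntegrableOn.congr_fun ?_ e1.symm measurableSet_Ioc
    exact (Continuous.integrableOn_Icc (by fun_prop)).mono_set Set.Ioc_subset_Icc_self
  have hlt : (-(2 * k + 3) : ℝ) < -1 := by
    linarith [(Nat.cast_nonneg k : (0 : ℝ) ≤ k)]
  have i2 : IntegrableOn (fun r => r ^ 5 * radialFactor k r ρ ^ 2) (Set.Ioi ρ) :=
    IntegrableOn.congr_fun ((integrableOn_Ioi_rpow_of_lt hlt hρ).const_mul _) e2.symm
      measurableSet_Ioi
  rw [← Set.Ioc_union_Ioi_eq_Ioi hρ.le]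
  refine ⟨i1.union i2, ?_⟩
  rw [setIntegral_union (Set.Ioc_disjoint_Ioi le_rfl) measurableSet_Ioi i1 i2,
    setIntegral_congr_fun measurableSet_Ioc e1, setIntegral_congr_fun measurableSet_Ioi e2,
    integral_const_mul, integral_mul_const, ← intervalIntegral.integral_of_le hρ.le, integral_pow,
    integral_Ioi_rpow_of_lt hlt hρ,
    show (-(2 * k + 3) + 1 : ℝ) = -((2 * k + 2 : ℕ) : ℝ) by push_cast; ring, rpow_neg hρ.le,
    rpow_natCast]
  push_cast
  have hk : (2 * (k : ℝ) + 2) ≠ 0 := by positivity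
  rw [zero_pow (by omega)]
  field_simp
  ring

/-- The function `u_k(|y|) Y_{k,j}(y / |y|)`, whose integral against `f` gives the coefficient of
the Newtonian potential of `f` on the sphere of radius `ρ`. -/
def coeffKernel (Y : (k : ℕ) → Fin (harmonicDim k) → S5 → ℝ) (ρ : ℝ) (k : ℕ)
    (j : Fin (harmonicDim k)) (y : E6) : ℝ :=
  radialFactor k ‖y‖ ρ * Y k j (unitDir y)

/-- The common squared norm of the functions `coeffKernel Y ρ k j` in `L²(ℝ⁶)`. -/
def coeffNormSq (ρ : ℝ) (k : ℕ) : ℝ := π ^ 3 * ((ρ ^ 2)⁻¹ * (1 / (2 * k + 6) + 1 / (2 * k + 2)))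

lemma coeffNormSq_pos {ρ : ℝ} (hρ : 0 < ρ) (k : ℕ) : 0 < coeffNormSq ρ k := by
  unfold coeffNormSq; positivity

lemma coeffNormSq_le {ρ : ℝ} (hρ : 0 < ρ) (k : ℕ) :
    coeffNormSq ρ k ≤ π ^ 3 * (ρ ^ 2)⁻¹ * (k + 1 : ℝ)⁻¹ := by
  rw [coeffNormSq, ← mul_assoc]
  gcongr
  have h : (1 : ℝ) / (2 * k + 6) ≤ 1 / (2 * k + 2) := by gcongr; norm_num
  have h2 : (k + 1 : ℝ)⁻¹ = 1 / (2 * k + 2) + 1 / (2 * k + 2) := by field_simp; norm_num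
  linarith

namespace IsHarmonicBasis

lemma measurable_coeffKernel (hY : IsHarmonicBasis Y) (ρ : ℝ) (k : ℕ) (j : Fin (harmonicDim k)) :
    Measurable (coeffKernel Y ρ k j) := by
  unfold coeffKernel radialFactor
  exact (by fun_prop : Measurable fun y : E6 => min ‖y‖ ρ ^ k / max ‖y‖ ρ ^ (k + 4)).mul
    ((hY.continuous k j).measurable.comp measurable_unitDir)

lemma integrable_coeffKernel_mul (hY : IsHarmonicBasis Y) {ρ : ℝ} (hρ : 0 < ρ) (k : ℕ)
    (i j : Fin (harmonicDim k)) :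
    Integrable (fun y => coeffKernel Y ρ k i y * coeffKernel Y ρ k j y) ∧
      ∫ y, coeffKernel Y ρ k i y * coeffKernel Y ρ k j y = if i = j then coeffNormSq ρ k else 0 := by
  have hcomp : (fun y => coeffKernel Y ρ k i y * coeffKernel Y ρ k j y) ∘ polarMap =
      fun p => Y k i p.1 * Y k j p.1 * radialFactor k p.2 ρ ^ 2 := by
    funext p
    simp only [Function.comp_apply, coeffKernel, norm_polarMap, unitDir_polarMap]
    ring
  obtain ⟨h1, h2⟩ := integral_radialFactor_sq k hρ
  constructor
  · rw [← measurePreserving_polarMap.integrable_comp_emb measurableEmbedding_polarMap, hcomp]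
    have hr := (integrable_volumeIoiPow_iff 5 fun r => radialFactor k r ρ ^ 2).2 h1
    have hs := integrable_of_continuous ((hY.continuous k i).mul (hY.continuous k j))
    exact hs.mul_prod hr
  · rw [← measurePreserving_polarMap.integral_comp measurableEmbedding_polarMap]
    have := congrFun hcomp
    simp only [Function.comp_apply] at this
    simp only [this]
    rw [integral_prod_mul (fun ξ => Y k i ξ * Y k j ξ)
      (fun r : Set.Ioi (0 : ℝ) => radialFactor k r ρ ^ 2),
      integral_volumeIoiPow 5 (fun r => radialFactor k r ρ ^ 2), h2, hY.integral_mul, coeffNormSq]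
    split_ifs <;> simp

lemma memLp_coeffKernel (hY : IsHarmonicBasis Y) {ρ : ℝ} (hρ : 0 < ρ) (k : ℕ)
    (j : Fin (harmonicDim k)) : MemLp (coeffKernel Y ρ k j) 2 (volume : Measure E6) := by
  rw [memLp_two_iff_integrable_sq (hY.measurable_coeffKernel ρ k j).aestronglyMeasurable]
  simpa only [pow_two] using (hY.integrable_coeffKernel_mul hρ k j j).1

end IsHarmonicBasis

lemma kernel_eq (k : ℕ) {r ρ : ℝ} (hr : 0 < r) :
    kernel k r ρ = 2 * π ^ 3 / (k + 2) * (r ^ 5 * radialFactor k r ρ) := by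
  rw [kernel, radialFactor]
  congr 1
  split_ifs with h
  · rw [min_eq_left h.le, max_eq_right h.le]
    ring
  · rw [min_eq_right (not_lt.1 h), max_eq_left (not_lt.1 h), zpow_sub₀ hr.ne', zpow_natCast,
      zpow_one]
    field_simp
    ring

lemma memLp_integrable_mul {α : Type*} [MeasurableSpace α] {μ : Measure α} {f g : α → ℝ}
    (hf : MemLp f 2 μ) (hg : MemLp g 2 μ) : Integrable (fun x => f x * g x) μ :=
  hf.integrable_mul hg

/-- The radial integral converges absolutely, and it is an inner product in `L²(ℝ⁶)`. -/
theorem IsHarmonicBasis.radialIntegral_eq (hY : IsHarmonicBasis Y) {f : E6 → ℝ}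
    (hf : MemLp f 2 volume) {ρ : ℝ} (hρ : 0 < ρ) (k : ℕ) (j : Fin (harmonicDim k)) :
    IntegrableOn (fun r => kernel k r ρ * coeff (Y k j) f r) (Set.Ioi (0 : ℝ)) ∧
      radialIntegral k (Y k j) f ρ = 2 / (k + 2) * ∫ y, coeffKernel Y ρ k j y * f y := by
  have hint := memLp_integrable_mul (hY.memLp_coeffKernel hρ k j) hf
  have hcomp : (fun y => coeffKernel Y ρ k j y * f y) ∘ polarMap =
      fun p => radialFactor k p.2 ρ * (f ((p.2 : ℝ) • (p.1 : E6)) * Y k j p.1) := by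
    funext p
    simp only [Function.comp_apply, coeffKernel, norm_polarMap, unitDir_polarMap]
    rw [polarMap]
    ring
  have hpol := hint
  rw [← measurePreserving_polarMap.integrable_comp_emb measurableEmbedding_polarMap, hcomp] at hpol
  have hker : Set.EqOn (fun r => kernel k r ρ * coeff (Y k j) f r)
      (fun r => 2 / (k + 2) * (r ^ 5 * ∫ ξ : S5, radialFactor k r ρ *
        (f (r • (ξ : E6)) * Y k j ξ) ∂surfaceMeasure)) (Set.Ioi 0) := by
    intro r hr
    simp only [kernel_eq k (Set.mem_Ioi.1 hr), coeff, integral_const_mul]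
    field_simp
  constructor
  · refine IntegrableOn.congr_fun (Integrable.const_mul ?_ _) hker.symm measurableSet_Ioi
    exact (integrable_volumeIoiPow_iff 5 fun r => ∫ ξ : S5, radialFactor k r ρ *
      (f (r • (ξ : E6)) * Y k j ξ) ∂surfaceMeasure).1 hpol.integral_prod_right
  · rw [radialIntegral, setIntegral_congr_fun measurableSet_Ioi hker, integral_const_mul,
      ← measurePreserving_polarMap.integral_comp measurableEmbedding_polarMap]
    have := congrFun hcomp
    simp only [Function.comp_apply] at this
    simp only [this]
    rw [integral_prod_symm _ hpol, ← integral_volumeIoiPow 5 fun r => ∫ ξ : S5,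
      radialFactor k r ρ * (f (r • (ξ : E6)) * Y k j ξ) ∂surfaceMeasure]

/-! ### Bounds in `L²` for the terms of the series -/

lemma integral_sum_mul_sum {α ι : Type*} [MeasurableSpace α] {μ : Measure α} [Fintype ι]
    [DecidableEq ι] {ψ : ι → α → ℝ} {N : ℝ}
    (hint : ∀ i j, Integrable (fun x => ψ i x * ψ j x) μ)
    (horth : ∀ i j, ∫ x, ψ i x * ψ j x ∂μ = if i = j then N else 0) (a : ι → ℝ) :
    ∫ x, (∑ j, a j * ψ j x) ^ 2 ∂μ = N * ∑ j, a j ^ 2 := by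
  have h : ∀ x, (∑ j, a j * ψ j x) ^ 2 = ∑ i, ∑ j, a i * a j * (ψ i x * ψ j x) := fun x => by
    rw [pow_two, Finset.sum_mul_sum]
    exact Finset.sum_congr rfl fun i _ => Finset.sum_congr rfl fun j _ => by ring
  simp only [h]
  rw [integral_finsetSum _ fun i _ => integrable_finsetSum _ fun j _ => (hint i j).const_mul _]
  simp only [integral_finsetSum _ fun j _ => (hint _ j).const_mul _, integral_const_mul, horth]
  simp only [mul_ite, mul_zero, Finset.sum_ite_eq, Finset.mem_univ, if_true, Finset.mul_sum]
  exact Finset.sum_congr rfl fun i _ => by ring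

/-- Bessel's inequality for an orthogonal family of functions with common squared norm `N`. -/
lemma sum_sq_integral_mul_le {α ι : Type*} [MeasurableSpace α] {μ : Measure α} [Fintype ι]
    [DecidableEq ι] {ψ : ι → α → ℝ} {f : α → ℝ} {N : ℝ} (hN : 0 < N)
    (hψ : ∀ i, MemLp (ψ i) 2 μ) (hf : MemLp f 2 μ)
    (horth : ∀ i j, ∫ x, ψ i x * ψ j x ∂μ = if i = j then N else 0) :
    ∑ j, (∫ x, ψ j x * f x ∂μ) ^ 2 ≤ N * ∫ x, f x ^ 2 ∂μ := by
  set a : ι → ℝ := fun j => ∫ x, ψ j x * f x ∂μ with ha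
  have hint : ∀ i j, Integrable (fun x => ψ i x * ψ j x) μ := fun i j =>
    memLp_integrable_mul (hψ i) (hψ j)
  have hg : MemLp (fun x => ∑ j, a j * ψ j x) 2 μ :=
    memLp_finsetSum _ fun j _ => (hψ j).const_mul (a j)
  have h1 : Integrable (fun x => f x ^ 2) μ := hf.integrable_sq
  have h2 : Integrable (fun x => (∑ j, a j * ψ j x) ^ 2) μ := hg.integrable_sq
  have h3 : Integrable (fun x => f x * ∑ j, a j * ψ j x) μ := memLp_integrable_mul hf hg
  have h4 : ∫ x, f x * ∑ j, a j * ψ j x ∂μ = ∑ j, a j ^ 2 := by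
    have : ∀ x, f x * ∑ j, a j * ψ j x = ∑ j, a j * (ψ j x * f x) := fun x => by
      rw [Finset.mul_sum]
      exact Finset.sum_congr rfl fun j _ => by ring
    simp only [this]
    rw [integral_finsetSum _ fun j _ => (memLp_integrable_mul (hψ j) hf).const_mul _]
    simp only [integral_const_mul]
    exact Finset.sum_congr rfl fun j _ => by rw [ha]; ring
  have h5 := integral_sum_mul_sum hint horth a
  -- `N⁻¹ ∑ aⱼ ψⱼ` is the orthogonal projection of `f`.
  have hnonneg : 0 ≤ ∫ x, (N * f x - ∑ j, a j * ψ j x) ^ 2 ∂μ :=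
    integral_nonneg fun x => sq_nonneg _
  have hexp : ∀ x, (N * f x - ∑ j, a j * ψ j x) ^ 2 =
      N ^ 2 * f x ^ 2 - 2 * N * (f x * ∑ j, a j * ψ j x) + (∑ j, a j * ψ j x) ^ 2 :=
    fun x => by ring
  simp only [hexp] at hnonneg
  have h6 : Integrable (fun x => N ^ 2 * f x ^ 2 - 2 * N * (f x * ∑ j, a j * ψ j x)) μ :=
    (h1.const_mul _).sub (h3.const_mul _)
  rw [integral_add h6 h2, integral_sub (h1.const_mul _) (h3.const_mul _), integral_const_mul,
    integral_const_mul, h4, h5] at hnonneg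
  refine le_of_mul_le_mul_left ?_ hN
  linarith

lemma eLpNorm_two_eq {α : Type*} [MeasurableSpace α] {μ : Measure α} {f : α → ℝ}
    (hf : MemLp f 2 μ) : eLpNorm f 2 μ = ENNReal.ofReal √(∫ x, f x ^ 2 ∂μ) := by
  rw [hf.eLpNorm_eq_integral_rpow_norm two_ne_zero ENNReal.ofNat_ne_top, Real.sqrt_eq_rpow]
  simp

lemma memLp_of_continuous {F : S5 → ℝ} (hF : Continuous F) : MemLp F 2 surfaceMeasure :=
  (memLp_two_iff_integrable_sq hF.aestronglyMeasurable).2 (integrable_of_continuous (hF.pow 2))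

/-- The term of degree `k` in the expansion of the Newtonian potential of `f` on the sphere of
radius `ρ`. -/
def degreeTerm (Y : (k : ℕ) → Fin (harmonicDim k) → S5 → ℝ) (f : E6 → ℝ) (ρ : ℝ) (k : ℕ)
    (ξ : S5) : ℝ :=
  ∑ j, radialIntegral k (Y k j) f ρ * Y k j ξ

/-- A bound for the norm of `f ↦ degreeTerm Y f ρ k` as an operator from `L²(ℝ⁶)` to `L²(𝕊⁵)`. -/
def degreeBound (ρ : ℝ) (k : ℕ) : ℝ := 2 * π ^ 3 / (ρ * ((k + 2) * √(k + 1)))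

lemma degreeBound_nonneg {ρ : ℝ} (hρ : 0 < ρ) (k : ℕ) : 0 ≤ degreeBound ρ k := by
  unfold degreeBound; positivity

lemma summable_degreeBound {ρ : ℝ} (hρ : 0 < ρ) : Summable (degreeBound ρ) := by
  have h : Summable fun k : ℕ => ((k + 1 : ℕ) : ℝ) ^ (-(3 / 2) : ℝ) :=
    (summable_nat_add_iff 1).2 (Real.summable_nat_rpow.2 (by norm_num))
  refine Summable.of_nonneg_of_le (degreeBound_nonneg hρ) (fun k => ?_)
    (h.mul_left (2 * π ^ 3 / ρ))
  have hk : (0 : ℝ) < k + 1 := by positivity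
  have hpow : ((k + 1 : ℕ) : ℝ) ^ (-(3 / 2) : ℝ) = ((k + 1) * √(k + 1))⁻¹ := by
    push_cast
    rw [rpow_neg hk.le, show (3 / 2 : ℝ) = 1 + 1 / 2 by norm_num, rpow_add hk, rpow_one,
      Real.sqrt_eq_rpow]
  rw [hpow, degreeBound, ← div_div, div_eq_mul_inv]
  gcongr
  norm_num

namespace IsHarmonicBasis

lemma continuous_degreeTerm (hY : IsHarmonicBasis Y) (f : E6 → ℝ) (ρ : ℝ) (k : ℕ) :
    Continuous (degreeTerm Y f ρ k) := by
  unfold degreeTerm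
  exact continuous_finsetSum _ fun j _ => continuous_const.mul (hY.continuous k j)

/-- Bessel's inequality in `L²(ℝ⁶)`, combined with the orthogonality of the basis on the sphere. -/
theorem eLpNorm_degreeTerm_le (hY : IsHarmonicBasis Y) {f : E6 → ℝ} (hf : MemLp f 2 volume)
    {ρ : ℝ} (hρ : 0 < ρ) (k : ℕ) :
    eLpNorm (degreeTerm Y f ρ k) 2 surfaceMeasure ≤
      ENNReal.ofReal (degreeBound ρ k) * eLpNorm f 2 volume := by
  rw [eLpNorm_two_eq (memLp_of_continuous (hY.continuous_degreeTerm f ρ k)), eLpNorm_two_eq hf,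
    ← ENNReal.ofReal_mul (degreeBound_nonneg hρ k)]
  refine ENNReal.ofReal_le_ofReal ?_
  rw [Real.sqrt_le_left (mul_nonneg (degreeBound_nonneg hρ k) (Real.sqrt_nonneg _)), mul_pow,
    Real.sq_sqrt (integral_nonneg fun x => sq_nonneg _)]
  have hint : ∀ i j, Integrable (fun ξ => Y k i ξ * Y k j ξ) surfaceMeasure := fun i j =>
    integrable_of_continuous ((hY.continuous k i).mul (hY.continuous k j))
  have h1 := integral_sum_mul_sum hint (hY.integral_mul k)
    fun j => radialIntegral k (Y k j) f ρ
  have h2 := sum_sq_integral_mul_le (coeffNormSq_pos hρ k) (hY.memLp_coeffKernel hρ k) hf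
    fun i j => (hY.integrable_coeffKernel_mul hρ k i j).2
  simp only [degreeTerm]
  rw [h1]
  simp only [(hY.radialIntegral_eq hf hρ k _).2, mul_pow]
  rw [← Finset.mul_sum]
  have hI : 0 ≤ ∫ x, f x ^ 2 := integral_nonneg fun x => sq_nonneg _
  calc π ^ 3 * ((2 / (k + 2)) ^ 2 * ∑ j, (∫ y, coeffKernel Y ρ k j y * f y) ^ 2)
      ≤ π ^ 3 * ((2 / (k + 2)) ^ 2 * (π ^ 3 * (ρ ^ 2)⁻¹ * (k + 1 : ℝ)⁻¹ * ∫ x, f x ^ 2)) := by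
        gcongr
        exact h2.trans (mul_le_mul_of_nonneg_right (coeffNormSq_le hρ k) hI)
    _ = degreeBound ρ k ^ 2 * ∫ x, f x ^ 2 := by
        have hk : √(k + 1 : ℝ) ^ 2 = k + 1 := Real.sq_sqrt (by positivity)
        have : degreeBound ρ k ^ 2 = (2 * π ^ 3) ^ 2 / (ρ ^ 2 * ((k + 2) ^ 2 * (k + 1))) := by
          rw [degreeBound, div_pow, mul_pow ρ, mul_pow _ √(k + 1 : ℝ), hk]
        rw [this]
        field_simp

lemma degreeTerm_sub (hY : IsHarmonicBasis Y) {f g : E6 → ℝ} (hf : MemLp f 2 volume)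
    (hg : MemLp g 2 volume) {ρ : ℝ} (hρ : 0 < ρ) (k : ℕ) (ξ : S5) :
    degreeTerm Y (f - g) ρ k ξ = degreeTerm Y f ρ k ξ - degreeTerm Y g ρ k ξ := by
  simp only [degreeTerm, (hY.radialIntegral_eq (hf.sub hg) hρ k _).2,
    (hY.radialIntegral_eq hf hρ k _).2, (hY.radialIntegral_eq hg hρ k _).2, Pi.sub_apply, mul_sub]
  rw [← Finset.sum_sub_distrib]
  refine Finset.sum_congr rfl fun j _ => ?_
  rw [integral_sub (memLp_integrable_mul (hY.memLp_coeffKernel hρ k j) hf)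
    (memLp_integrable_mul (hY.memLp_coeffKernel hρ k j) hg)]
  ring

/-- The term of degree `k` is the integral of `f` against the term of degree `k` in the expansion of
the Newtonian kernel. -/
lemma degreeTerm_eq_integral (hY : IsHarmonicBasis Y) {f : E6 → ℝ} (hf : MemLp f 2 volume)
    {ρ : ℝ} (hρ : 0 < ρ) (k : ℕ) (ξ : S5) :
    Integrable (fun y => f y *
      (2 / (k + 2) * reproducingKernel Y k ξ (unitDir y) * radialFactor k ‖y‖ ρ)) ∧
    ∫ y, f y * (2 / (k + 2) * reproducingKernel Y k ξ (unitDir y) * radialFactor k ‖y‖ ρ) =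
      degreeTerm Y f ρ k ξ := by
  have h : ∀ y, f y * (2 / (k + 2) * reproducingKernel Y k ξ (unitDir y) *
      radialFactor k ‖y‖ ρ) =
      ∑ j, 2 / (k + 2) * Y k j ξ * (coeffKernel Y ρ k j y * f y) := by
    intro y
    simp only [reproducingKernel, coeffKernel, Finset.mul_sum, Finset.sum_mul]
    exact Finset.sum_congr rfl fun j _ => by ring
  have hint := fun j => memLp_integrable_mul (hY.memLp_coeffKernel hρ k j) hf
  simp only [h]
  refine ⟨integrable_finsetSum _ fun j _ => (hint j).const_mul _, ?_⟩
  rw [integral_finsetSum _ fun j _ => (hint j).const_mul _, degreeTerm]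
  refine Finset.sum_congr rfl fun j _ => ?_
  rw [integral_const_mul, (hY.radialIntegral_eq hf hρ k j).2]
  ring

end IsHarmonicBasis

/-- A series whose terms have summable norms in `L²` converges absolutely almost everywhere. -/
lemma ae_summable_of_tsum_eLpNorm_ne_top {α : Type*} [MeasurableSpace α] {μ : Measure α}
    [IsFiniteMeasure μ] {h : ℕ → α → ℝ} (hm : ∀ k, AEStronglyMeasurable (h k) μ)
    (hb : ∑' k, eLpNorm (h k) 2 μ ≠ ⊤) : ∀ᵐ x ∂μ, Summable fun k => h k x := by
  have hle : ∫⁻ x, ∑' k, ‖h k x‖ₑ ∂μ ≠ ⊤ := by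
    rw [lintegral_tsum fun k => (hm k).enorm]
    refine ne_top_of_le_ne_top (ENNReal.mul_ne_top hb
      (ENNReal.rpow_ne_top_of_nonneg (y := 1 / 2) (by norm_num) (measure_ne_top μ Set.univ))) ?_
    rw [← ENNReal.tsum_mul_right]
    refine ENNReal.tsum_le_tsum fun k => ?_
    rw [← eLpNorm_one_eq_lintegral_enorm]
    refine (eLpNorm_le_eLpNorm_mul_rpow_measure_univ (q := 2) (by norm_num) (hm k)).trans
      (le_of_eq ?_)
    norm_num
  filter_upwards [ae_lt_top' (AEMeasurable.tsum fun k => (hm k).enorm) hle] with x hx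
  refine Summable.of_norm ?_
  have := ENNReal.summable_toReal hx.ne
  simpa using this

/-- The tails of a pointwise convergent series are bounded by the tails of the series of norms. -/
lemma eLpNorm_sub_sum_le {α : Type*} [MeasurableSpace α] {μ : Measure α} {h : ℕ → α → ℝ}
    (hm : ∀ k, AEStronglyMeasurable (h k) μ) {F : α → ℝ}
    (hF : ∀ᵐ x ∂μ, HasSum (fun k => h k x) (F x)) (n : ℕ) :
    eLpNorm (fun x => F x - ∑ k ∈ Finset.range n, h k x) 2 μ ≤
      ∑' k, eLpNorm (h (k + n)) 2 μ := by
  refine Lp.eLpNorm_le_of_ae_tendsto (u := atTop)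
    (f := fun N => ∑ k ∈ Finset.range N, h (k + n)) (.of_forall fun N => ?_) (fun N => ?_) ?_
  · exact (eLpNorm_sum_le (fun k _ => hm _) (by norm_num)).trans (ENNReal.sum_le_tsum _)
  · exact Finset.aestronglyMeasurable_sum _ fun k _ => hm _
  · filter_upwards [hF] with x hx
    have := ((hasSum_nat_add_iff' n).2 hx).tendsto_sum_nat
    simpa [Finset.sum_apply] using this

/-! ### The expansion on a single sphere -/

lemma memLp_radialFactor {ρ : ℝ} (hρ : 0 < ρ) (k : ℕ) :
    MemLp (fun y : E6 => radialFactor k ‖y‖ ρ) 2 volume := by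
  have hm : Measurable fun y : E6 => radialFactor k ‖y‖ ρ := by
    unfold radialFactor; fun_prop
  rw [memLp_two_iff_integrable_sq hm.aestronglyMeasurable]
  refine (integrable_fun_norm_addHaar (volume : Measure E6)
    (f := fun r => radialFactor k r ρ ^ 2)).2 ?_
  simpa using (integral_radialFactor_sq k hρ).1

lemma max_sub_min_le_norm_sub {ρ : ℝ} (hρ : 0 < ρ) (ξ : S5) (y : E6) :
    max ‖y‖ ρ - min ‖y‖ ρ ≤ ‖ρ • (ξ : E6) - y‖ := by
  have h := abs_norm_sub_norm_le (ρ • (ξ : E6)) y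
  rw [norm_smul, norm_eq_of_mem_sphere, mul_one, Real.norm_of_nonneg hρ.le, abs_sub_comm] at h
  rwa [max_sub_min_eq_abs']

/-- If `f` is supported away from the sphere of radius `ρ`, then the expansion of the Newtonian
kernel can be integrated term by term. -/
theorem IsHarmonicBasis.hasSum_of_support (hY : IsHarmonicBasis Y) {f : E6 → ℝ}
    (hf : MemLp f 2 volume) {ρ τ : ℝ} (hρ : 0 < ρ) (hτ : 0 ≤ τ) (hτ1 : τ < 1)
    (hsupp : ∀ y, f y ≠ 0 → min ‖y‖ ρ ≤ τ * max ‖y‖ ρ) (ξ : S5) :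
    Integrable (fun y => f y / ‖ρ • (ξ : E6) - y‖ ^ 4) ∧
      HasSum (fun k => degreeTerm Y f ρ k ξ) (newtonPotential f (ρ • (ξ : E6))) := by
  have hM : ∀ y : E6, 0 < max ‖y‖ ρ := fun y => lt_max_of_lt_right hρ
  have hw : Integrable fun y => ‖f y‖ * radialFactor 0 ‖y‖ ρ :=
    memLp_integrable_mul hf.norm (memLp_radialFactor hρ 0)
  have hw0 : ∀ y : E6, radialFactor 0 ‖y‖ ρ = 1 / max ‖y‖ ρ ^ 4 := fun y => by
    simp [radialFactor]
  constructor
  · have hm : Measurable fun y : E6 => (‖ρ • (ξ : E6) - y‖ ^ 4)⁻¹ := by fun_prop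
    refine (hw.mul_const (((1 - τ) ^ 4)⁻¹)).mono'
      ((hf.1.mul hm.aestronglyMeasurable).congr (.of_forall fun y => (div_eq_mul_inv _ _).symm))
      (.of_forall fun y => ?_)
    by_cases h0 : f y = 0
    · simp [h0]
    have h1 : (1 - τ) * max ‖y‖ ρ ≤ ‖ρ • (ξ : E6) - y‖ := by
      have := max_sub_min_le_norm_sub hρ ξ y
      have := hsupp y h0
      linarith
    have h2 : 0 < (1 - τ) * max ‖y‖ ρ := mul_pos (by linarith) (hM y)
    rw [norm_div, norm_pow, norm_norm, hw0, mul_assoc, div_eq_mul_inv]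
    refine mul_le_mul_of_nonneg_left ?_ (norm_nonneg _)
    rw [one_div, ← mul_inv, ← mul_pow, mul_comm (max ‖y‖ ρ)]
    gcongr
  · have hterm := hY.degreeTerm_eq_integral hf hρ
    have hbound : ∀ (k : ℕ) (y : E6),
        ‖f y * (2 / (k + 2) * reproducingKernel Y k ξ (unitDir y) * radialFactor k ‖y‖ ρ)‖ ≤
          harmonicDim k * τ ^ k * (‖f y‖ * radialFactor 0 ‖y‖ ρ) := by
      intro k y
      by_cases h0 : f y = 0
      · simp [h0]
      have h1 : min ‖y‖ ρ / max ‖y‖ ρ ≤ τ := (div_le_iff₀ (hM y)).2 (hsupp y h0)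
      have h2 : 0 ≤ min ‖y‖ ρ := le_min (norm_nonneg y) hρ.le
      rw [norm_mul, norm_mul, Real.norm_of_nonneg (radialFactor_nonneg (norm_nonneg y) hρ k),
        radialFactor_eq hρ, hw0]
      calc _ ≤ ‖f y‖ * (harmonicDim k * (τ ^ k / max ‖y‖ ρ ^ 4)) := by
            gcongr
            exact hY.abs_two_div_mul_le k ξ _
        _ = _ := by ring
    have hsum : Summable fun k : ℕ => ∫ y,
        ‖f y * (2 / (k + 2) * reproducingKernel Y k ξ (unitDir y) * radialFactor k ‖y‖ ρ)‖ := by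
      refine Summable.of_nonneg_of_le (fun k => integral_nonneg fun y => norm_nonneg _)
        (fun k => (integral_mono (hterm k ξ).1.norm (hw.const_mul _) (hbound k)).trans_eq
          (integral_const_mul _ _)) ?_
      exact (summable_harmonicDim_mul_pow (by rwa [abs_of_nonneg hτ])).mul_right _
    have h := hasSum_integral_of_summable_integral_norm (fun k => (hterm k ξ).1) hsum
    simp only [(hterm _ ξ).2] at h
    suffices newtonPotential f (ρ • (ξ : E6)) = ∫ y, ∑' k : ℕ,
        f y * (2 / (k + 2) * reproducingKernel Y k ξ (unitDir y) * radialFactor k ‖y‖ ρ) by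
      rwa [this]
    refine integral_congr_ae (.of_forall fun y => ?_)
    by_cases h0 : f y = 0
    · simp [h0]
    have hne : ‖y‖ ≠ ρ := by
      intro h1
      have := hsupp y h0
      rw [h1, min_self, max_self] at this
      nlinarith
    have := ((hY.hasSum_newton ξ (unitDir y) (norm_nonneg y) hρ hne).mul_left (f y)).tsum_eq
    rw [norm_smul_unitDir, mul_one_div] at this
    exact this.symm

/-- A bound for the operator from `L²(ℝ⁶)` to `L²` of the sphere of radius `ρ` given by the Newtonian
potential. -/
def potentialBound (ρ : ℝ) : ENNReal := ∑' k, ENNReal.ofReal (degreeBound ρ k)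

lemma potentialBound_ne_top {ρ : ℝ} (hρ : 0 < ρ) : potentialBound ρ ≠ ⊤ :=
  (summable_degreeBound hρ).tsum_ofReal_ne_top

lemma IsHarmonicBasis.tsum_eLpNorm_degreeTerm_le (hY : IsHarmonicBasis Y) {f : E6 → ℝ}
    (hf : MemLp f 2 volume) {ρ : ℝ} (hρ : 0 < ρ) :
    ∑' k, eLpNorm (degreeTerm Y f ρ k) 2 surfaceMeasure ≤ potentialBound ρ * eLpNorm f 2 volume := by
  rw [potentialBound, ← ENNReal.tsum_mul_right]
  exact ENNReal.tsum_le_tsum fun k => hY.eLpNorm_degreeTerm_le hf hρ k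

lemma IsHarmonicBasis.eLpNorm_le_of_hasSum (hY : IsHarmonicBasis Y) {f : E6 → ℝ}
    (hf : MemLp f 2 volume) {ρ : ℝ} (hρ : 0 < ρ) {F : S5 → ℝ}
    (hF : ∀ᵐ ξ ∂surfaceMeasure, HasSum (fun k => degreeTerm Y f ρ k ξ) (F ξ)) :
    eLpNorm F 2 surfaceMeasure ≤ potentialBound ρ * eLpNorm f 2 volume := by
  have h := eLpNorm_sub_sum_le
    (fun k => (hY.continuous_degreeTerm f ρ k).aestronglyMeasurable) hF 0
  simp only [Finset.range_zero, Finset.sum_empty, sub_zero, add_zero] at h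
  exact h.trans (hY.tsum_eLpNorm_degreeTerm_le hf hρ)

/-- The complement of a neighbourhood of the sphere of radius `ρ`; these sets exhaust the complement
of that sphere. -/
def awayFrom (ρ : ℝ) (n : ℕ) : Set E6 :=
  {y | min ‖y‖ ρ ≤ (1 - 1 / ((n : ℝ) + 1)) * max ‖y‖ ρ}

lemma measurableSet_awayFrom (ρ : ℝ) (n : ℕ) : MeasurableSet (awayFrom ρ n) :=
  measurableSet_le (by fun_prop) (by fun_prop)

lemma monotone_awayFrom {ρ : ℝ} (hρ : 0 < ρ) : Monotone (awayFrom ρ) := by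
  intro m n hmn y hy
  refine le_trans (Set.mem_ofPred.1 hy) ?_
  have : 0 < max ‖y‖ ρ := lt_max_of_lt_right hρ
  gcongr

lemma eventually_mem_awayFrom {ρ : ℝ} (hρ : 0 < ρ) {y : E6} (hy : ‖y‖ ≠ ρ) :
    ∀ᶠ n in atTop, y ∈ awayFrom ρ n := by
  have hM : 0 < max ‖y‖ ρ := lt_max_of_lt_right hρ
  have h1 : min ‖y‖ ρ / max ‖y‖ ρ < 1 := (div_lt_one hM).2 (min_lt_max.2 hy)
  have h2 : Tendsto (fun n : ℕ => 1 - 1 / ((n : ℝ) + 1)) atTop (𝓝 1) := by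
    simpa using tendsto_const_nhds.sub (tendsto_one_div_add_atTop_nhds_zero_nat (𝕜 := ℝ))
  filter_upwards [h2.eventually (eventually_gt_nhds h1)] with n hn
  exact ((div_lt_iff₀ hM).1 hn).le

lemma ae_norm_ne {ρ : ℝ} (hρ : 0 < ρ) : ∀ᵐ y : E6, ‖y‖ ≠ ρ := by
  have h := Measure.addHaar_sphere_of_ne_zero (volume : Measure E6) (0 : E6) hρ.ne'
  rw [measure_eq_zero_iff_ae_notMem] at h
  filter_upwards [h] with y hy
  simpa using hy

lemma IsHarmonicBasis.hasSum_indicator (hY : IsHarmonicBasis Y) {f : E6 → ℝ}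
    (hf : MemLp f 2 volume) {ρ : ℝ} (hρ : 0 < ρ) (n : ℕ) (ξ : S5) :
    Integrable (fun y => (awayFrom ρ n).indicator f y / ‖ρ • (ξ : E6) - y‖ ^ 4) ∧
      HasSum (fun k => degreeTerm Y ((awayFrom ρ n).indicator f) ρ k ξ)
        (newtonPotential ((awayFrom ρ n).indicator f) (ρ • (ξ : E6))) := by
  have h1 : 1 / ((n : ℝ) + 1) ≤ 1 := by
    rw [div_le_one (by positivity)]
    linarith [(Nat.cast_nonneg n : (0 : ℝ) ≤ n)]
  have h2 : 0 < 1 / ((n : ℝ) + 1) := by positivity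
  refine hY.hasSum_of_support (hf.indicator (measurableSet_awayFrom ρ n)) hρ
    (τ := 1 - 1 / ((n : ℝ) + 1)) (by linarith) (by linarith) (fun y hy => ?_) ξ
  have : y ∈ awayFrom ρ n := Set.mem_of_indicator_ne_zero hy
  exact this

lemma tendsto_eLpNorm_sub_indicator {f : E6 → ℝ} (hf : MemLp f 2 volume) {ρ : ℝ} (hρ : 0 < ρ) :
    Tendsto (fun n => eLpNorm (f - (awayFrom ρ n).indicator f) 2 volume) atTop (𝓝 0) := by
  have key : Tendsto (fun n => ∫⁻ y, ‖(f - (awayFrom ρ n).indicator f) y‖ₑ ^ (2 : ℝ)) atTop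
      (𝓝 (∫⁻ _ : E6, 0)) := by
    refine tendsto_lintegral_of_dominated_convergence' (fun y => ‖f y‖ₑ ^ (2 : ℝ))
      (fun n => ((hf.1.sub (hf.1.indicator (measurableSet_awayFrom ρ n))).enorm.pow_const _))
      (fun n => .of_forall fun y => ?_) ?_ ?_
    · refine ENNReal.rpow_le_rpow ?_ (by norm_num)
      by_cases hy : y ∈ awayFrom ρ n <;> simp [hy]
    · have := lintegral_rpow_enorm_lt_top_of_eLpNorm_lt_top two_ne_zero ENNReal.ofNat_ne_top hf.2
      simpa using this.ne
    · filter_upwards [ae_norm_ne hρ] with y hy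
      refine tendsto_const_nhds.congr' ?_
      filter_upwards [eventually_mem_awayFrom hρ hy] with n hn
      simp [hn]
  rw [lintegral_zero] at key
  have h := ((ENNReal.continuous_rpow_const (y := 1 / 2)).tendsto 0).comp key
  rw [ENNReal.zero_rpow_of_pos (by norm_num)] at h
  refine h.congr fun n => ?_
  rw [eLpNorm_eq_lintegral_rpow_enorm_toReal two_ne_zero ENNReal.ofNat_ne_top]
  simp

/-- On every sphere around the origin, the integral defining the Newtonian potential converges
absolutely almost everywhere. -/
theorem IsHarmonicBasis.ae_integrable (hY : IsHarmonicBasis Y) {f : E6 → ℝ} (hfm : Measurable f)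
    (hf : MemLp f 2 volume) {ρ : ℝ} (hρ : 0 < ρ) :
    ∀ᵐ ξ : S5 ∂surfaceMeasure, Integrable fun y => f y / ‖ρ • (ξ : E6) - y‖ ^ 4 := by
  -- Increasing truncations of the integral of `|f(y)| / |ρξ - y|⁴`, with integrals over the sphere
  -- bounded through the expansion of the potential of the truncations of `|f|`.
  set I : ℕ → S5 → ENNReal := fun n ξ =>
    ∫⁻ y, (awayFrom ρ n).indicator (fun y => ‖f y / ‖ρ • (ξ : E6) - y‖ ^ 4‖ₑ) y with hI
  have hquot : Measurable fun p : S5 × E6 => ‖f p.2 / ‖ρ • (p.1 : E6) - p.2‖ ^ 4‖ₑ := by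
    fun_prop
  have hmeas : ∀ n, Measurable (I n) := fun n => by
    refine Measurable.lintegral_prod_right' (f := fun p : S5 × E6 =>
      (awayFrom ρ n).indicator (fun y => ‖f y / ‖ρ • (p.1 : E6) - y‖ ^ 4‖ₑ) p.2) ?_
    exact hquot.indicator (measurable_snd (measurableSet_awayFrom ρ n))
  have hmono : Monotone I := fun m n hmn ξ => lintegral_mono fun y =>
    Set.indicator_le_indicator_of_subset (monotone_awayFrom hρ hmn) (fun _ => zero_le) y
  have hsup : ∀ ξ : S5, ∫⁻ y, ‖f y / ‖ρ • (ξ : E6) - y‖ ^ 4‖ₑ = ⨆ n, I n ξ := by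
    intro ξ
    rw [hI, ← lintegral_iSup (fun n => ?_) (fun m n hmn y =>
      Set.indicator_le_indicator_of_subset (monotone_awayFrom hρ hmn) (fun _ => zero_le) y)]
    · refine lintegral_congr_ae ?_
      filter_upwards [ae_norm_ne hρ] with y hy
      obtain ⟨n, hn⟩ := (eventually_mem_awayFrom hρ hy).exists
      refine le_antisymm ?_ (iSup_le fun n => Set.indicator_le_self _ _ y)
      exact le_iSup_of_le n (by rw [Set.indicator_of_mem hn])
    · exact (hquot.comp measurable_prodMk_left).indicator (measurableSet_awayFrom ρ n)
  have hbound : ∀ n, ∫⁻ ξ, I n ξ ∂surfaceMeasure ≤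
      potentialBound ρ * eLpNorm f 2 volume * surfaceMeasure Set.univ ^ (1 / 2 : ℝ) := by
    intro n
    have hh := hY.hasSum_indicator hf.norm hρ n
    have h1 : ∀ ξ, I n ξ =
        ‖newtonPotential ((awayFrom ρ n).indicator fun y => ‖f y‖) (ρ • (ξ : E6))‖ₑ := by
      intro ξ
      have hnn : ∀ y, 0 ≤ (awayFrom ρ n).indicator (fun y => ‖f y‖) y / ‖ρ • (ξ : E6) - y‖ ^ 4 :=
        fun y => div_nonneg (Set.indicator_nonneg (fun _ _ => norm_nonneg _) _) (by positivity)
      rw [newtonPotential, Real.enorm_of_nonneg (integral_nonneg hnn),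
        ofReal_integral_eq_lintegral_ofReal (hh ξ).1 (.of_forall hnn)]
      refine lintegral_congr fun y => ?_
      rw [← Real.enorm_of_nonneg (hnn y)]
      by_cases hy : y ∈ awayFrom ρ n
      · rw [Set.indicator_of_mem hy, Set.indicator_of_mem hy, ← enorm_norm (f y / _), norm_div, norm_pow,
          norm_norm]
      · simp [hy]
    have h2 := hY.eLpNorm_le_of_hasSum
      (hf.norm.indicator (measurableSet_awayFrom ρ n)) hρ (.of_forall fun ξ => (hh ξ).2)
    have h3 : AEStronglyMeasurable (fun ξ : S5 =>
        newtonPotential ((awayFrom ρ n).indicator fun y => ‖f y‖) (ρ • (ξ : E6)))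
        surfaceMeasure :=
      aestronglyMeasurable_of_tendsto_ae atTop (fun N => (continuous_finsetSum (Finset.range N)
        fun k _ => hY.continuous_degreeTerm _ ρ k).aestronglyMeasurable)
        (.of_forall fun ξ => (hh ξ).2.tendsto_sum_nat)
    simp only [h1]
    rw [← eLpNorm_one_eq_lintegral_enorm]
    refine (eLpNorm_le_eLpNorm_mul_rpow_measure_univ (q := 2) (by norm_num) h3).trans ?_
    refine mul_le_mul' (h2.trans (mul_le_mul_right ?_ _)) (le_of_eq (by norm_num))
    exact (eLpNorm_indicator_le _).trans_eq (eLpNorm_norm f)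
  have hfin : ∫⁻ ξ, (⨆ n, I n ξ) ∂surfaceMeasure ≠ ⊤ := by
    rw [lintegral_iSup hmeas hmono]
    exact ne_top_of_le_ne_top (ENNReal.mul_ne_top (ENNReal.mul_ne_top (potentialBound_ne_top hρ)
      hf.2.ne) (ENNReal.rpow_ne_top_of_nonneg (by norm_num) (measure_ne_top _ _))) (iSup_le hbound)
  filter_upwards [ae_lt_top (.iSup hmeas) hfin] with ξ hξ
  refine ⟨(hfm.div (by fun_prop)).aestronglyMeasurable, ?_⟩
  rwa [hasFiniteIntegral_iff_enorm, hsup]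

/-- The expansion of the Newtonian potential at almost every point of a given sphere. -/
theorem IsHarmonicBasis.ae_hasSum (hY : IsHarmonicBasis Y) {f : E6 → ℝ} (hfm : Measurable f)
    (hf : MemLp f 2 volume) {ρ : ℝ} (hρ : 0 < ρ) :
    ∀ᵐ ξ : S5 ∂surfaceMeasure,
      HasSum (fun k => degreeTerm Y f ρ k ξ) (newtonPotential f (ρ • (ξ : E6))) := by
  have hsummable := ae_summable_of_tsum_eLpNorm_ne_top
    (fun k => (hY.continuous_degreeTerm f ρ k).aestronglyMeasurable)
    (ne_top_of_le_ne_top (ENNReal.mul_ne_top (potentialBound_ne_top hρ) hf.2.ne)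
      (hY.tsum_eLpNorm_degreeTerm_le hf hρ))
  -- The limit `F` of the series differs from the potentials `Fn` of the truncations by the series of
  -- `f` minus its truncations, and both `Fn → F` in `L²` and `Fn → Φ f` almost everywhere.
  set F : S5 → ℝ := fun ξ => ∑' k, degreeTerm Y f ρ k ξ with hF
  set Fn : ℕ → S5 → ℝ := fun n ξ =>
    newtonPotential ((awayFrom ρ n).indicator f) (ρ • (ξ : E6)) with hFn
  have hind := fun n => hf.indicator (measurableSet_awayFrom ρ n)
  have hdiff : ∀ n, ∀ᵐ ξ ∂surfaceMeasure,
      HasSum (fun k => degreeTerm Y (f - (awayFrom ρ n).indicator f) ρ k ξ) (F ξ - Fn n ξ) := by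
    intro n
    filter_upwards [hsummable] with ξ hξ
    simp only [hY.degreeTerm_sub hf (hind n) hρ]
    exact hξ.hasSum.sub (hY.hasSum_indicator hf hρ n ξ).2
  have hle : ∀ n, eLpNorm (fun ξ => F ξ - Fn n ξ) 2 surfaceMeasure ≤
      potentialBound ρ * eLpNorm (f - (awayFrom ρ n).indicator f) 2 volume := fun n =>
    hY.eLpNorm_le_of_hasSum (hf.sub (hind n)) hρ (hdiff n)
  have hmeas : ∀ n, AEStronglyMeasurable (fun ξ => F ξ - Fn n ξ) surfaceMeasure := fun n =>
    aestronglyMeasurable_of_tendsto_ae atTop (fun N => (continuous_finsetSum (Finset.range N)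
      fun k _ => hY.continuous_degreeTerm _ ρ k).aestronglyMeasurable)
      ((hdiff n).mono fun ξ hξ => hξ.tendsto_sum_nat)
  have hlim : ∀ᵐ ξ : S5 ∂surfaceMeasure, Tendsto (fun n => F ξ - Fn n ξ) atTop
      (𝓝 (F ξ - newtonPotential f (ρ • (ξ : E6)))) := by
    filter_upwards [hY.ae_integrable hfm hf hρ] with ξ hξ
    refine tendsto_const_nhds.sub ?_
    refine tendsto_integral_of_dominated_convergence (fun y => ‖f y / ‖ρ • (ξ : E6) - y‖ ^ 4‖)
      (fun n => (hY.hasSum_indicator hf hρ n ξ).1.1) hξ.norm (fun n => .of_forall fun y => ?_) ?_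
    · by_cases hy : y ∈ awayFrom ρ n <;> simp [hy]
      positivity
    · filter_upwards [ae_norm_ne hρ] with y hy
      refine tendsto_const_nhds.congr' ?_
      filter_upwards [eventually_mem_awayFrom hρ hy] with n hn
      rw [Set.indicator_of_mem hn]
  have hzero : eLpNorm (fun ξ : S5 => F ξ - newtonPotential f (ρ • (ξ : E6))) 2
      surfaceMeasure = 0 := by
    refine le_antisymm ?_ (zero_le)
    refine (Lp.eLpNorm_lim_le_liminf_eLpNorm hmeas _ hlim).trans ?_
    have h0 := ENNReal.Tendsto.const_mul (tendsto_eLpNorm_sub_indicator hf hρ)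
      (.inr (potentialBound_ne_top hρ))
    rw [mul_zero] at h0
    exact (tendsto_of_tendsto_of_tendsto_of_le_of_le tendsto_const_nhds h0
      (fun _ => zero_le) hle).liminf_eq.le
  rw [eLpNorm_eq_zero_iff (aestronglyMeasurable_of_tendsto_ae atTop hmeas hlim) two_ne_zero] at hzero
  filter_upwards [hzero, hsummable] with ξ h1 h2
  rw [← sub_eq_zero.1 h1]
  exact h2.hasSum

/-! ### The expansion almost everywhere in space -/

lemma measurableSet_hasSum {α : Type*} [MeasurableSpace α] {g : ℕ → α → ℝ} {h : α → ℝ}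
    (hg : ∀ k, Measurable (g k)) (hh : Measurable h) :
    MeasurableSet {x | HasSum (fun k => g k x) (h x)} := by
  have : {x | HasSum (fun k => g k x) (h x)} = {x | ∑' k, ‖g k x‖ₑ < ⊤} ∩
      {x | Tendsto (fun N => ∑ k ∈ Finset.range N, g k x) atTop (𝓝 (h x))} := by
    ext x
    have hiff : ∑' k, ‖g k x‖ₑ < ⊤ ↔ Summable fun k => g k x := by
      rw [lt_top_iff_ne_top, ← summable_norm_iff]
      exact ENNReal.tsum_coe_ne_top_iff_summable.trans NNReal.summable_coe.symm
    simp only [Set.mem_ofPred, Set.mem_inter_iff, hiff]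
    exact ⟨fun hs => ⟨hs.summable, hs.tendsto_sum_nat⟩,
      fun hs => (hs.1.hasSum_iff_tendsto_nat).2 hs.2⟩
  rw [this]
  exact (measurableSet_lt (.tsum fun k => (hg k).enorm) measurable_const).inter
    (measurableSet_tendsto_fun (fun N => Finset.measurable_fun_sum _ fun k _ => hg k) hh)

namespace IsHarmonicBasis

lemma measurable_degreeTerm (hY : IsHarmonicBasis Y) {f : E6 → ℝ} (hfm : Measurable f)
    (hf : MemLp f 2 volume) (k : ℕ) :
    Measurable fun p : Set.Ioi (0 : ℝ) × S5 => degreeTerm Y f p.1 k p.2 := by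
  unfold degreeTerm
  refine Finset.measurable_fun_sum _ fun j _ => ?_
  refine Measurable.mul ?_ ((hY.continuous k j).measurable.comp measurable_snd)
  suffices Measurable fun r : Set.Ioi (0 : ℝ) => radialIntegral k (Y k j) f r from
    this.comp measurable_fst
  have : (fun r : Set.Ioi (0 : ℝ) => radialIntegral k (Y k j) f r) =
      fun r : Set.Ioi (0 : ℝ) => 2 / (k + 2) * ∫ y, coeffKernel Y r k j y * f y :=
    funext fun r => (hY.radialIntegral_eq hf r.2 k j).2
  rw [this]
  refine measurable_const.mul (StronglyMeasurable.integral_prod_right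
    (f := fun (r : Set.Ioi (0 : ℝ)) y => coeffKernel Y r k j y * f y) ?_).measurable
  refine Measurable.stronglyMeasurable ?_
  unfold coeffKernel radialFactor
  refine Measurable.mul (Measurable.mul (by fun_prop) ?_) (hfm.comp measurable_snd)
  exact (hY.continuous k j).measurable.comp (measurable_unitDir.comp measurable_snd)

/-- The expansion at almost every point of `ℝ⁶`: the set of good points is measurable and meets
every sphere around the origin in a set of full measure. -/
theorem ae_expansion (hY : IsHarmonicBasis Y) {f : E6 → ℝ} (hfm : Measurable f)
    (hf : MemLp f 2 volume) :
    ∀ᵐ x : E6, Integrable (fun y => f y / ‖x - y‖ ^ 4) ∧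
      HasSum (fun k => degreeTerm Y f ‖x‖ k (unitDir x)) (newtonPotential f x) := by
  suffices ∀ᵐ x ∂((surfaceMeasure.prod (Measure.volumeIoiPow 5)).map polarMap),
      Integrable (fun y => f y / ‖x - y‖ ^ 4) ∧
        HasSum (fun k => degreeTerm Y f ‖x‖ k (unitDir x)) (newtonPotential f x) by
    rwa [measurePreserving_polarMap.map_eq] at this
  rw [measurableEmbedding_polarMap.ae_map_iff]
  suffices ∀ᵐ p ∂((Measure.volumeIoiPow 5).prod surfaceMeasure),
      Integrable (fun y => f y / ‖polarMap p.swap - y‖ ^ 4) ∧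
        HasSum (fun k => degreeTerm Y f p.1 k p.2) (newtonPotential f (polarMap p.swap)) by
    have h := (Measure.measurePreserving_swap (μ := surfaceMeasure)
      (ν := Measure.volumeIoiPow 5)).quasiMeasurePreserving.ae this
    filter_upwards [h] with p hp
    rwa [norm_polarMap, unitDir_polarMap]
  have hquot : Measurable fun q : (Set.Ioi (0 : ℝ) × S5) × E6 =>
      f q.2 / ‖polarMap q.1.swap - q.2‖ ^ 4 := by
    have : Measurable fun q : (Set.Ioi (0 : ℝ) × S5) × E6 => polarMap q.1.swap :=
      measurableEmbedding_polarMap.measurable.comp (measurable_swap.comp measurable_fst)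
    fun_prop
  rw [Measure.ae_prod_iff_ae_ae]
  · refine .of_forall fun r => ?_
    filter_upwards [hY.ae_integrable hfm hf r.2, hY.ae_hasSum hfm hf r.2] with ξ h1 h2
    exact ⟨h1, h2⟩
  · have hint : MeasurableSet {p : Set.Ioi (0 : ℝ) × S5 |
        Integrable (fun y => f y / ‖polarMap p.swap - y‖ ^ 4)} := by
      have : {p : Set.Ioi (0 : ℝ) × S5 |
          Integrable (fun y => f y / ‖polarMap p.swap - y‖ ^ 4)} =
          {p | ∫⁻ y, ‖f y / ‖polarMap p.swap - y‖ ^ 4‖ₑ < ⊤} := by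
        ext p
        exact ⟨fun h => h.2, fun h => ⟨(hquot.comp measurable_prodMk_left).aestronglyMeasurable, h⟩⟩
      rw [this]
      exact measurableSet_lt (Measurable.lintegral_prod_right' hquot.enorm) measurable_const
    exact hint.inter <| measurableSet_hasSum (hY.measurable_degreeTerm hfm hf)
        (StronglyMeasurable.integral_prod_right' hquot.stronglyMeasurable).measurable

/-- The expansion in `L²` of a given sphere. -/
theorem tendsto_eLpNorm (hY : IsHarmonicBasis Y) {f : E6 → ℝ} (hfm : Measurable f)
    (hf : MemLp f 2 volume) {ρ : ℝ} (hρ : 0 < ρ) :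
    Tendsto (fun N : ℕ => eLpNorm (fun ξ : S5 => newtonPotential f (ρ • (ξ : E6)) -
      ∑ k ∈ Finset.range N, degreeTerm Y f ρ k ξ) 2 surfaceMeasure) atTop (𝓝 0) := by
  have hfin := ne_top_of_le_ne_top (ENNReal.mul_ne_top (potentialBound_ne_top hρ) hf.2.ne)
    (hY.tsum_eLpNorm_degreeTerm_le hf hρ)
  exact tendsto_of_tendsto_of_tendsto_of_le_of_le tendsto_const_nhds
    (ENNReal.tendsto_sum_nat_add _ hfin) (fun _ => zero_le) fun n =>
    eLpNorm_sub_sum_le (fun k => (hY.continuous_degreeTerm f ρ k).aestronglyMeasurable)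
      (hY.ae_hasSum hfm hf hρ) n

end IsHarmonicBasis

lemma newtonPotential_congr {f g : E6 → ℝ} (h : f =ᵐ[volume] g) :
    newtonPotential f = newtonPotential g :=
  funext fun _ => integral_congr_ae (h.mono fun y hy => by simp only [hy])

lemma IsHarmonicBasis.degreeTerm_congr (hY : IsHarmonicBasis Y) {f g : E6 → ℝ}
    (hf : MemLp f 2 volume) (h : f =ᵐ[volume] g) {ρ : ℝ} (hρ : 0 < ρ) (k : ℕ) (ξ : S5) :
    degreeTerm Y f ρ k ξ = degreeTerm Y g ρ k ξ := by
  refine Finset.sum_congr rfl fun j _ => ?_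
  rw [(hY.radialIntegral_eq hf hρ k j).2, (hY.radialIntegral_eq (hf.ae_eq h) hρ k j).2]
  congr 2
  exact integral_congr_ae (h.mono fun y hy => by simp only [hy])

end NewtonHarmonic

end

theorem proposition2p3
    (Y : (k : ℕ) → Fin (NewtonHarmonic.harmonicDim k) → NewtonHarmonic.S5 → ℝ)
    (hY : NewtonHarmonic.IsHarmonicBasis Y)
    (f : NewtonHarmonic.E6 → ℝ) (hf : MemLp f 2 (volume : Measure NewtonHarmonic.E6)) :
    (∀ (k : ℕ) (j : Fin (NewtonHarmonic.harmonicDim k)) (ρ : ℝ), 0 < ρ →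
      IntegrableOn (fun r => NewtonHarmonic.kernel k r ρ * NewtonHarmonic.coeff (Y k j) f r)
        (Set.Ioi (0 : ℝ))) ∧
    (∀ᵐ x : NewtonHarmonic.E6, ∀ hx : x ≠ 0,
      Integrable (fun y : NewtonHarmonic.E6 => f y / ‖x - y‖ ^ 4) ∧
      HasSum
        (fun k : ℕ => ∑ j : Fin (NewtonHarmonic.harmonicDim k),
          NewtonHarmonic.radialIntegral k (Y k j) f ‖x‖ *
            Y k j (NewtonHarmonic.direction x hx))
        (NewtonHarmonic.newtonPotential f x)) ∧
    (∀ ρ : ℝ, 0 < ρ →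
      Tendsto
        (fun N : ℕ => eLpNorm
          (fun ξ : NewtonHarmonic.S5 =>
            NewtonHarmonic.newtonPotential f (ρ • (ξ : NewtonHarmonic.E6)) -
              ∑ k ∈ Finset.range N, ∑ j : Fin (NewtonHarmonic.harmonicDim k),
                NewtonHarmonic.radialIntegral k (Y k j) f ρ * Y k j ξ)
          2 NewtonHarmonic.surfaceMeasure)
        atTop (𝓝 0)) := by
  have hfg := hf.1.ae_eq_mk
  have hgm := hf.1.stronglyMeasurable_mk.measurable
  have hg := hf.ae_eq hfg
  have hterm := fun {ρ : ℝ} (hρ : 0 < ρ) k ξ => hY.degreeTerm_congr hf hfg hρ k ξ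
  have hpot := NewtonHarmonic.newtonPotential_congr hfg
  refine ⟨fun k j ρ hρ => (hY.radialIntegral_eq hf hρ k j).1, ?_, fun ρ hρ => ?_⟩
  · filter_upwards [hY.ae_expansion hgm hg] with x hx hx0
    refine ⟨hx.1.congr (hfg.mono fun y hy => by simp only [hy]), ?_⟩
    have hsum := hx.2
    simp only [← hterm (norm_pos_iff.2 hx0), ← hpot] at hsum
    rw [NewtonHarmonic.unitDir, dif_neg hx0] at hsum
    exact hsum
  · have hlim := hY.tendsto_eLpNorm hgm hg hρ
    simp only [← hterm hρ, ← hpot] at hlim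
    exact hlim
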